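/- Setting. Let $\Gamma=(V,E)$ be a finite connected undirected graph without loops or multiple edges, with vertices $i\in V$, neighbour sets $N(i)$ and edge weights $w_{ij}=w_{ji}>0$. Let $\mathcal P=\{\rho\in\mathbb R^V:\rho_i\ge 0,\ \sum_i\rho_i=1\}$, let $\mathcal P_o=\{\rho\in\mathcal P:\rho_i>0\ \forall i\}$, and let $\theta_{ij}(\rho)=\frac{\rho_i+\rho_j}{2}$. Let $T>0$, $\mu_0\in\mathcal P$, and let $\mathcal F,\mathcal G:\mathcal P\to\mathbb R$ be convex and differentiable at the points of $\mathcal P_o$ (along $\mathcal P$), with first variations $f,g:\mathcal P_o\to\mathbb R^V$, i.e. $\delta\mathcal F(\rho)=\sum_i f_i(\rho)\,\delta\rho_i$ and $\delta\mathcal G(\rho)=\sum_i g_i(\rho)\,\delta\rho_i$; assume that $f$ is continuously differentiable on $\mathcal P_o$. Graph MFG-PW: minimize $$J_1(\rho,v)=\int_0^T\Big(\tfrac14\sum_{i}\sum_{j\in N(i)}v_{ij}^2\,\theta_{ij}(\rho)+\mathcal F(\rho(t))\Big)dt+\mathcal G(\rho(T))$$ over all curves $\rho:[0,T]\to\mathcal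 P$ and measurable velocity fields $v$, skew-symmetric and supported on the edges, for which the kinetic energy and $\mathcal F(\rho(\cdot))$ are integrable on $[0,T]$, subject to $\frac{d\rho_i}{dt}=\sum_{j\in N(i)}\sqrt{w_{ij}}\,v_{ij}\theta_{ij}(\rho)$ (in integrated form, with integrable right-hand side) and $\rho(0)=\mu_0$. Graph MFG-IV: minimize $$J_2(S_0)=\int_0^T\Big(\tfrac14\sum_i\sum_{j\in N(i)}w_{ij}(S_i-S_j)^2\theta_{ij}(\rho)+\mathcal F(\rho(t))\Big)dt+\mathcal G(\rho(T))$$ over all $S_0\in\mathbb R^V$ for which the coupled system $$\frac{d\rho_i}{dt}=\sum_{j\in N(i)}w_{ij}(S_j-S_i)\theta_{ij}(\rho),\qquad -\frac{dS_i}{dt}+\frac12\sum_{j\in N(i)}w_{ij}(S_i-S_j)^2\frac{\partial\theta_{ij}(\rho)}{\partial\rho_i}=f_i(\rho),\qquad \rho(0)=\mu_0,\ S(0)=S_0$$ has a solution $(\rho,S)$ on $[0,T]$ with $\rho(t)\in\mathcal P_o$ for all $t\in[0,T]$ (the trajectory generated from $S_0$). Theorem. (I) If $S_0^*$ is a minimizer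 of Graph MFG-IV, then the trajectory $(\rho^*,S^*)$ generated from it, together with $v^*_{ij}=\sqrt{w_{ij}}(S^*_j-S^*_i)$ on edges, gives a minimizer $(\rho^*,v^*)$ of Graph MFG-PW. (II) Conversely, let $(\hat\rho,\hat v)$ be a minimizer of Graph MFG-PW with $\hat\rho(t)\in\mathcal P_o$ for all $t\in[0,T]$. Then it has a value function: there is $\hat S$ such that $(\hat\rho,\hat S)$ solves the coupled continuity / Hamilton–Jacobi system on $[0,T]$ with $\hat\rho(0)=\mu_0$ and $\hat S(T)=g(\hat\rho(T))$, and $\hat v_{ij}=\sqrt{w_{ij}}(\hat S_j-\hat S_i)$ on edges for almost every $t\in[0,T]$. For every such $\hat S$, the initial value $\hat S(0)$ is a minimizer of Graph MFG-IV. -/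

import Mathlib

/-! Potential mean field games on a finite weighted graph `(Γ, w)` with vertex set `V`.
A density is a vector `ρ : V → ℝ` in `stdSimplex ℝ V`, a value function is a vector `S : V → ℝ`,
and a velocity field is an edge function `v : V → V → ℝ`. -/

noncomputable section

namespace GraphMFG

/-- The interior of the probability simplex: all nodes carry positive mass. -/
def openSimplex (V : Type*) [Fintype V] : Set (V → ℝ) :=
  {ρ | ρ ∈ stdSimplex ℝ V ∧ ∀ i, 0 < ρ i}

/-- The averaged edge density. -/
def theta {V : Type*} (ρ : V → ℝ) (i j : V) : ℝ := (ρ i + ρ j) / 2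

/-- The partial derivative of the edge density with respect to `ρ i`, for an edge `(i, j)`;
see `hasDerivAt_theta`. -/
def dtheta : ℝ := 1 / 2

theorem hasDerivAt_theta {V : Type*} [DecidableEq V] (ρ : V → ℝ) {i j : V} (h : i ≠ j) :
    HasDerivAt (fun x : ℝ => theta (Function.update ρ i x) i j) dtheta (ρ i) := by
  have h2 : (fun x : ℝ => theta (Function.update ρ i x) i j) = fun x => (x + ρ j) / 2 := by
    funext x
    simp [theta, Function.update_of_ne h.symm]
  rw [h2]
  exact ((hasDerivAt_id (ρ i)).add_const (ρ j)).div_const 2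

/-- A velocity field on the graph: skew-symmetric and supported on the edges. -/
def IsVectorField {V : Type*} (Γ : SimpleGraph V) (v : V → V → ℝ) : Prop :=
  (∀ i j, v i j = -v j i) ∧ ∀ i j, ¬ Γ.Adj i j → v i j = 0

/-- The inner product `⟨v, u⟩_ρ`; each undirected edge is counted twice, whence the factor. -/
def edgeInner {V : Type*} [Fintype V] (Γ : SimpleGraph V) [DecidableRel Γ.Adj]
    (ρ : V → ℝ) (v u : V → V → ℝ) : ℝ :=
  (1 / 2) * ∑ i, ∑ j ∈ Γ.neighborFinset i, v i j * u i j * theta ρ i j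

/-- The kinetic energy `𝒦(ρ, v) = ⟨v, v⟩_ρ / 2`. -/
def kinetic {V : Type*} [Fintype V] (Γ : SimpleGraph V) [DecidableRel Γ.Adj]
    (ρ : V → ℝ) (v : V → V → ℝ) : ℝ :=
  (1 / 2) * edgeInner Γ ρ v v

/-- The `i`-th component of the graph divergence of `ρ v`. -/
def divG {V : Type*} [Fintype V] (Γ : SimpleGraph V) [DecidableRel Γ.Adj]
    (w : V → V → ℝ) (ρ : V → ℝ) (v : V → V → ℝ) (i : V) : ℝ :=
  -∑ j ∈ Γ.neighborFinset i, Real.sqrt (w i j) * v i j * theta ρ i j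

/-- The velocity field induced by a value function: `v_ij = √w_ij (S_j - S_i)` on edges. -/
def velocity {V : Type*} (Γ : SimpleGraph V) [DecidableRel Γ.Adj]
    (w : V → V → ℝ) (S : V → ℝ) (i j : V) : ℝ :=
  if Γ.Adj i j then Real.sqrt (w i j) * (S j - S i) else 0

/-- `f` is a first variation of the potential `F` on the open simplex:
`δF(ρ) = ∑ i, f_i(ρ) δρ_i` along the simplex. -/
def IsFirstVariation {V : Type*} [Fintype V] (F : (V → ℝ) → ℝ) (f : (V → ℝ) → V → ℝ) : Prop :=
  ∀ ρ ∈ openSimplex V,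
    HasFDerivWithinAt F (∑ i, f ρ i • (ContinuousLinearMap.proj i : (V → ℝ) →L[ℝ] ℝ))
      (stdSimplex ℝ V) ρ

/-- Admissible pairs of the path-wise problem: curves of densities and measurable velocity fields
of finite cost. The continuity equation `ρ' + div_G (ρ v) = 0`, `ρ(0) = μ₀` is taken in the
Carathéodory sense, i.e. in integrated form (equivalently: `ρ` is absolutely continuous and
the equation holds for almost every time). -/
structure IsPWAdmissible {V : Type*} [Fintype V] (Γ : SimpleGraph V) [DecidableRel Γ.Adj]
    (w : V → V → ℝ) (F : (V → ℝ) → ℝ) (μ₀ : V → ℝ) (T : ℝ)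
    (ρ : ℝ → V → ℝ) (v : ℝ → V → V → ℝ) : Prop where
  mem_simplex : ∀ t ∈ Set.Icc 0 T, ρ t ∈ stdSimplex ℝ V
  vectorField : ∀ t ∈ Set.Icc 0 T, IsVectorField Γ (v t)
  measurable : ∀ i j, AEMeasurable (fun t => v t i j)
    (MeasureTheory.volume.restrict (Set.Icc 0 T))
  kinetic_integrable : IntervalIntegrable (fun t => kinetic Γ (ρ t) (v t))
    MeasureTheory.volume 0 T
  potential_integrable : IntervalIntegrable (fun t => F (ρ t)) MeasureTheory.volume 0 T
  flux_integrable : ∀ i, IntervalIntegrable (fun t => divG Γ w (ρ t) (v t) i)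
    MeasureTheory.volume 0 T
  continuity : ∀ t ∈ Set.Icc 0 T, ∀ i,
    ρ t i = μ₀ i - ∫ s in (0 : ℝ)..t, divG Γ w (ρ s) (v s) i

/-- The cost `J₁` of the path-wise problem. -/
def costPW {V : Type*} [Fintype V] (Γ : SimpleGraph V) [DecidableRel Γ.Adj]
    (F G : (V → ℝ) → ℝ) (T : ℝ) (ρ : ℝ → V → ℝ) (v : ℝ → V → V → ℝ) : ℝ :=
  (∫ t in (0 : ℝ)..T, (kinetic Γ (ρ t) (v t) + F (ρ t))) + G (ρ T)

/-- `(ρ, v)` is a minimizer of the path-wise problem (Graph MFG-PW). -/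
def IsPWMinimizer {V : Type*} [Fintype V] (Γ : SimpleGraph V) [DecidableRel Γ.Adj]
    (w : V → V → ℝ) (F G : (V → ℝ) → ℝ) (μ₀ : V → ℝ) (T : ℝ)
    (ρ : ℝ → V → ℝ) (v : ℝ → V → V → ℝ) : Prop :=
  IsPWAdmissible Γ w F μ₀ T ρ v ∧
    ∀ ρ' v', IsPWAdmissible Γ w F μ₀ T ρ' v' → costPW Γ F G T ρ v ≤ costPW Γ F G T ρ' v'

/-- The coupled continuity / Hamilton–Jacobi system on `[0, T]`, posed for densities in the
open simplex, where the first variation `f` is defined. The derivatives are one-sided at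
the end points. -/
structure SolvesCoupledSystem {V : Type*} [Fintype V] (Γ : SimpleGraph V) [DecidableRel Γ.Adj]
    (w : V → V → ℝ) (f : (V → ℝ) → V → ℝ) (T : ℝ) (ρ S : ℝ → V → ℝ) : Prop where
  mem_openSimplex : ∀ t ∈ Set.Icc 0 T, ρ t ∈ openSimplex V
  continuity : ∀ t ∈ Set.Icc 0 T, ∀ i, HasDerivWithinAt (fun s => ρ s i)
    (∑ j ∈ Γ.neighborFinset i, w i j * (S t j - S t i) * theta (ρ t) i j) (Set.Icc 0 T) t
  hamiltonJacobi : ∀ t ∈ Set.Icc 0 T, ∀ i, HasDerivWithinAt (fun s => S s i)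
    ((1 / 2) * (∑ j ∈ Γ.neighborFinset i, w i j * (S t i - S t j) ^ 2 * dtheta) - f (ρ t) i)
    (Set.Icc 0 T) t

/-- `(ρ, S)` is the trajectory on `[0, T]` generated from the initial data `(μ₀, S₀)`. -/
def IsTrajectory {V : Type*} [Fintype V] (Γ : SimpleGraph V) [DecidableRel Γ.Adj]
    (w : V → V → ℝ) (f : (V → ℝ) → V → ℝ) (μ₀ : V → ℝ) (T : ℝ)
    (S₀ : V → ℝ) (ρ S : ℝ → V → ℝ) : Prop :=
  SolvesCoupledSystem Γ w f T ρ S ∧ ρ 0 = μ₀ ∧ S 0 = S₀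

/-- The cost `J₂` of the initial value problem, evaluated on the generated trajectory. -/
def costIV {V : Type*} [Fintype V] (Γ : SimpleGraph V) [DecidableRel Γ.Adj]
    (w : V → V → ℝ) (F G : (V → ℝ) → ℝ) (T : ℝ) (ρ S : ℝ → V → ℝ) : ℝ :=
  (∫ t in (0 : ℝ)..T,
    ((∑ i, (1 / 4) * ∑ j ∈ Γ.neighborFinset i,
        w i j * (S t i - S t j) ^ 2 * theta (ρ t) i j) + F (ρ t))) + G (ρ T)

/-- `S₀` is a minimizer of the initial value problem (Graph MFG-IV): it generates a trajectory
up to time `T`, and the cost of that trajectory is at most the cost of the trajectory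
generated by any other initial value that generates one up to time `T`. -/
def IsIVMinimizer {V : Type*} [Fintype V] (Γ : SimpleGraph V) [DecidableRel Γ.Adj]
    (w : V → V → ℝ) (F G : (V → ℝ) → ℝ) (f : (V → ℝ) → V → ℝ) (μ₀ : V → ℝ) (T : ℝ)
    (S₀ : V → ℝ) : Prop :=
  (∃ ρ S, IsTrajectory Γ w f μ₀ T S₀ ρ S) ∧
    ∀ ρ S, IsTrajectory Γ w f μ₀ T S₀ ρ S →
      ∀ S₀' ρ' S', IsTrajectory Γ w f μ₀ T S₀' ρ' S' →
        costIV Γ w F G T ρ S ≤ costIV Γ w F G T ρ' S'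

/-- `S` is a value function of the pair `(ρ, v)`: the triple satisfies the Nash equilibrium
system with initial density `μ₀` and terminal value `g (ρ T)`. As `v` is only determined up to
null sets of times, the relation `v_ij = √w_ij (S_j - S_i)` is required almost everywhere. -/
def IsValueFunction {V : Type*} [Fintype V] (Γ : SimpleGraph V) [DecidableRel Γ.Adj]
    (w : V → V → ℝ) (f g : (V → ℝ) → V → ℝ) (μ₀ : V → ℝ) (T : ℝ)
    (ρ : ℝ → V → ℝ) (v : ℝ → V → V → ℝ) (S : ℝ → V → ℝ) : Prop :=
  SolvesCoupledSystem Γ w f T ρ S ∧ ρ 0 = μ₀ ∧ S T = g (ρ T) ∧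
    ∀ᵐ t ∂(MeasureTheory.volume.restrict (Set.Icc 0 T)), v t = velocity Γ w (S t)

end GraphMFG

end

open GraphMFG

/-!
The coupled system is Hamiltonian, with `S` playing the role of minus the momentum, for an action
that is convex in the density and the flux `v θ(ρ)`.

*Convexity.* Along a trajectory `(ρ, S)` the running cost of any competitor is bounded below by the
linearization of the cost at `(ρ, √w ∇S)`; integrating `⟨S, ρ' - ρ⟩` by parts turns the linear terms
into the boundary term `⟨S(T), ρ'(T) - ρ(T)⟩` (`SolvesCoupledSystem.action_le`). Hence a trajectory
for which `S(T) - g(ρ(T))` is constant on the graph minimizes the path-wise problem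
(`SolvesCoupledSystem.isPWMinimizer`).

*Transversality.* If `S₀` minimizes the initial value problem, then `p = S(T) - g(ρ(T))` is constant
(`SolvesCoupledSystem.terminal_eq_of_adj`). Otherwise `p` differs at the ends of some edge, and it
suffices to find perturbed initial values whose terminal densities satisfy `⟨p, Δρ(T)⟩ ≥ c ε`, since
by the convexity inequality the cost then drops. To find them, solve the system backward from
`(ρ(T), S(T) + ε p)`, let `a` be the resulting displacement of the initial density, and solve forward
from `(ρ(0), S(0) - a)`. The symplectic form of the increments of these two perturbed trajectories
is conserved up to `o(ε²)`, because the system is Hamiltonian and the derivative of `f` is symmetric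
(`IsFirstVariation.exists_increment_symm`). It equals `|a|²` at time `0` and `ε ⟨p, Δρ(T)⟩` at
time `T`. Finally `|a| ≥ c ε`: the pairing `⟨ΔS, Δρ⟩` of the backward perturbation is nonincreasing,
vanishes at `T`, and decays at a rate controlled by `|∇ΔS|²`, which is of order `ε²` near `T`.

*Euler–Lagrange equation.* Given an interior path-wise minimizer, let `S` be the primitive of
`∑ v_ij² / 4 - f_i(ρ)` with terminal value `g(ρ(T))`. Perturbing the flux in a bounded direction `n`
and integrating by parts, the first variation of the cost is the integral of the edge pairing of
`v - √w ∇S` with `n`; taking `n` opposite to the defect forces `v = √w ∇S` almost everywhere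
(`IsPWMinimizer.exists_isValueFunction`). As every trajectory of the coupled system is a competitor
in the path-wise problem, and trajectories are unique, `S(0)` minimizes the initial value problem
(`IsPWMinimizer.isIVMinimizer`).
-/

namespace GraphMFG

open MeasureTheory Set Filter Topology

noncomputable section

/-- The right-hand side of the continuity equation for the velocity field induced by `S`. -/
def densityRate {V : Type*} [Fintype V] (Γ : SimpleGraph V) [DecidableRel Γ.Adj]
    (w : V → V → ℝ) (ρ S : V → ℝ) (i : V) : ℝ :=
  ∑ j ∈ Γ.neighborFinset i, w i j * (S j - S i) * theta ρ i j

/-- The quadratic part of the right-hand side of the Hamilton–Jacobi equation. -/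
def valueRate {V : Type*} [Fintype V] (Γ : SimpleGraph V) [DecidableRel Γ.Adj]
    (w : V → V → ℝ) (S : V → ℝ) (i : V) : ℝ :=
  (1 / 2) * ∑ j ∈ Γ.neighborFinset i, w i j * (S i - S j) ^ 2 * dtheta

/-! ### Summation by parts on the graph -/

section Graph

theorem theta_comm {V : Type*} (ρ : V → ℝ) (i j : V) : theta ρ i j = theta ρ j i := by
  simp [theta, add_comm]

theorem theta_sub {V : Type*} (ρ ρ' : V → ℝ) (i j : V) :
    theta (fun k => ρ k - ρ' k) i j = theta ρ i j - theta ρ' i j := by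
  simp only [theta]; ring

theorem isVectorField_velocity {V : Type*} (Γ : SimpleGraph V) [DecidableRel Γ.Adj]
    {w : V → V → ℝ} (hw : ∀ i j, w i j = w j i) (S : V → ℝ) :
    IsVectorField Γ (velocity Γ w S) := by
  refine ⟨fun i j => ?_, fun i j h => by simp [velocity, h]⟩
  by_cases h : Γ.Adj i j
  · simp only [velocity, h, h.symm, if_true, hw i j]; ring
  · have h' : ¬ Γ.Adj j i := fun h' => h h'.symm
    simp [velocity, h, h']

variable {V : Type*} [Fintype V] (Γ : SimpleGraph V) [DecidableRel Γ.Adj]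

theorem sum_neighbor_comm (A : V → V → ℝ) :
    ∑ i, ∑ j ∈ Γ.neighborFinset i, A i j = ∑ i, ∑ j ∈ Γ.neighborFinset i, A j i := by
  refine Finset.sum_comm' fun i j => ?_
  simp [Γ.adj_comm]

/-- Summation by parts: a skew edge function is tested against differences of the vertex values. -/
theorem sum_mul_sum_skew {m : V → V → ℝ} (hm : ∀ i j, m i j = -m j i) (a : V → ℝ) :
    ∑ i, a i * ∑ j ∈ Γ.neighborFinset i, m i j
      = (1 / 2) * ∑ i, ∑ j ∈ Γ.neighborFinset i, (a i - a j) * m i j := by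
  have h1 : ∑ i, a i * ∑ j ∈ Γ.neighborFinset i, m i j
      = ∑ i, ∑ j ∈ Γ.neighborFinset i, a i * m i j := by
    simp only [Finset.mul_sum]
  have h2 : ∑ i, ∑ j ∈ Γ.neighborFinset i, a i * m i j
      = -∑ i, ∑ j ∈ Γ.neighborFinset i, a j * m i j := by
    rw [sum_neighbor_comm]
    simp only [← Finset.sum_neg_distrib]
    refine Finset.sum_congr rfl fun i _ => Finset.sum_congr rfl fun j _ => ?_
    rw [hm j i]; ring
  have h3 : ∑ i, ∑ j ∈ Γ.neighborFinset i, (a i - a j) * m i j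
      = ∑ i, ∑ j ∈ Γ.neighborFinset i, a i * m i j
        - ∑ i, ∑ j ∈ Γ.neighborFinset i, a j * m i j := by
    simp only [sub_mul, Finset.sum_sub_distrib]
  rw [h1, h3]; linarith

variable {w : V → V → ℝ}

theorem sum_mul_densityRate (hw : ∀ i j, w i j = w j i) (a ρ S : V → ℝ) :
    ∑ i, a i * densityRate Γ w ρ S i
      = -((1 / 2) * ∑ i, ∑ j ∈ Γ.neighborFinset i,
          w i j * (a i - a j) * (S i - S j) * theta ρ i j) := by
  simp only [densityRate]
  rw [sum_mul_sum_skew Γ (fun i j => ?_) a]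
  · simp only [← mul_neg, ← Finset.sum_neg_distrib]
    congr 1
    refine Finset.sum_congr rfl fun i _ => Finset.sum_congr rfl fun j _ => ?_
    ring
  · rw [hw i j, theta_comm ρ i j]; ring

theorem sum_densityRate (hw : ∀ i j, w i j = w j i) (ρ S : V → ℝ) :
    ∑ i, densityRate Γ w ρ S i = 0 := by
  have := sum_mul_densityRate Γ hw (fun _ => 1) ρ S
  simpa using this

/-- Summing a symmetric edge function against the vertex values `b` produces the edge averages
of `b`. -/
theorem sum_mul_sum_symm {A : V → V → ℝ} (hA : ∀ i j, A i j = A j i) (b : V → ℝ) :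
    ∑ i, b i * ∑ j ∈ Γ.neighborFinset i, A i j
      = ∑ i, ∑ j ∈ Γ.neighborFinset i, A i j * theta b i j := by
  have h1 : ∑ i, b i * ∑ j ∈ Γ.neighborFinset i, A i j
      = ∑ i, ∑ j ∈ Γ.neighborFinset i, b i * A i j := by
    simp only [Finset.mul_sum]
  have h2 : ∑ i, ∑ j ∈ Γ.neighborFinset i, b i * A i j
      = ∑ i, ∑ j ∈ Γ.neighborFinset i, b j * A i j := by
    rw [sum_neighbor_comm]
    refine Finset.sum_congr rfl fun i _ => Finset.sum_congr rfl fun j _ => ?_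
    rw [hA j i]
  have h3 : ∑ i, ∑ j ∈ Γ.neighborFinset i, A i j * theta b i j
      = (1 / 2) * (∑ i, ∑ j ∈ Γ.neighborFinset i, b i * A i j
        + ∑ i, ∑ j ∈ Γ.neighborFinset i, b j * A i j) := by
    simp only [← Finset.sum_add_distrib, Finset.mul_sum]
    refine Finset.sum_congr rfl fun i _ => Finset.sum_congr rfl fun j _ => ?_
    simp only [theta]; ring
  rw [h1, h3]; linarith

theorem sum_mul_valueRate (hw : ∀ i j, w i j = w j i) (b S : V → ℝ) :
    ∑ i, b i * valueRate Γ w S i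
      = (1 / 4) * ∑ i, ∑ j ∈ Γ.neighborFinset i, w i j * (S i - S j) ^ 2 * theta b i j := by
  rw [← sum_mul_sum_symm Γ (A := fun i j => w i j * (S i - S j) ^ 2)
    (fun i j => by rw [hw i j]; ring), Finset.mul_sum]
  refine Finset.sum_congr rfl fun i _ => ?_
  simp only [valueRate, dtheta, ← Finset.sum_mul]; ring

theorem divG_velocity (hw : ∀ i j, Γ.Adj i j → 0 < w i j) (ρ S : V → ℝ) (i : V) :
    divG Γ w ρ (velocity Γ w S) i = -densityRate Γ w ρ S i := by
  simp only [divG, densityRate]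
  congr 1
  refine Finset.sum_congr rfl fun j hj => ?_
  have hij : Γ.Adj i j := by simpa using hj
  simp only [velocity, hij, if_true]
  rw [← mul_assoc, Real.mul_self_sqrt (hw i j hij).le]

theorem kinetic_eq (ρ : V → ℝ) (v : V → V → ℝ) :
    kinetic Γ ρ v = (1 / 4) * ∑ i, ∑ j ∈ Γ.neighborFinset i, v i j ^ 2 * theta ρ i j := by
  simp only [kinetic, edgeInner, ← sq]; ring

theorem kinetic_velocity (hw : ∀ i j, Γ.Adj i j → 0 < w i j) (ρ S : V → ℝ) :
    kinetic Γ ρ (velocity Γ w S)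
      = (1 / 4) * ∑ i, ∑ j ∈ Γ.neighborFinset i, w i j * (S i - S j) ^ 2 * theta ρ i j := by
  rw [kinetic_eq]
  congr 1
  refine Finset.sum_congr rfl fun i _ => Finset.sum_congr rfl fun j hj => ?_
  have hij : Γ.Adj i j := by simpa using hj
  simp only [velocity, hij, if_true]
  rw [mul_pow, Real.sq_sqrt (hw i j hij).le]; ring

theorem sum_mul_divG (hw : ∀ i j, w i j = w j i) {v : V → V → ℝ} (hv : ∀ i j, v i j = -v j i)
    (a ρ : V → ℝ) :
    ∑ i, a i * divG Γ w ρ v i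
      = -((1 / 2) * ∑ i, ∑ j ∈ Γ.neighborFinset i,
          (a i - a j) * (Real.sqrt (w i j) * v i j * theta ρ i j)) := by
  simp only [divG, mul_neg, Finset.sum_neg_distrib]
  rw [sum_mul_sum_skew Γ (fun i j => ?_) a]
  rw [hw i j, hv i j, theta_comm ρ i j]; ring

end Graph

/-! ### Calculus on an interval -/

section Calculus

theorem sub_le_of_hasDerivWithinAt_le {h h' : ℝ → ℝ} {a b C : ℝ} (hab : a ≤ b)
    (hh : ∀ t ∈ Icc a b, HasDerivWithinAt h (h' t) (Icc a b) t) (hC : ∀ t ∈ Icc a b, h' t ≤ C) :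
    h b - h a ≤ C * (b - a) := by
  have hd : ∀ t ∈ Ioo a b, HasDerivAt h (h' t) t := fun t ht =>
    (hh t (Ioo_subset_Icc_self ht)).hasDerivAt (Icc_mem_nhds ht.1 ht.2)
  refine (convex_Icc a b).image_sub_le_mul_sub_of_deriv_le
    (fun t ht => (hh t ht).continuousWithinAt) ?_ ?_ a ⟨le_rfl, hab⟩ b ⟨hab, le_rfl⟩ hab
  · intro t ht
    rw [interior_Icc] at ht
    exact (hd t ht).differentiableAt.differentiableWithinAt
  · intro t ht
    rw [interior_Icc] at ht
    rw [(hd t ht).deriv]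
    exact hC t (Ioo_subset_Icc_self ht)

/-- Integration by parts for two functions given as primitives of integrable functions. -/
theorem integral_by_parts_of_primitive {a b α β : ℝ → ℝ} {T : ℝ} (hT : 0 ≤ T)
    (hα : IntervalIntegrable α volume 0 T) (hβ : IntervalIntegrable β volume 0 T)
    (ha : ∀ t ∈ Icc 0 T, a t = a 0 + ∫ s in (0 : ℝ)..t, α s)
    (hb : ∀ t ∈ Icc 0 T, b t = b 0 + ∫ s in (0 : ℝ)..t, β s) :
    ∫ t in (0 : ℝ)..T, (α t * b t + a t * β t) = a T * b T - a 0 * b 0 := by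
  have hprim : ∀ {c : ℝ} {γ : ℝ → ℝ}, IntervalIntegrable γ volume 0 T →
      AbsolutelyContinuousOnInterval (fun t => c + ∫ s in (0 : ℝ)..t, γ s) 0 T := by
    intro c γ hγ
    have h1 : AbsolutelyContinuousOnInterval (fun _ : ℝ => c) 0 T :=
      (LipschitzWith.const c).lipschitzOnWith.absolutelyContinuousOnInterval
    exact h1.add (hγ.absolutelyContinuousOnInterval_intervalIntegral left_mem_uIcc)
  have hder : ∀ {c : ℝ} {γ : ℝ → ℝ}, IntervalIntegrable γ volume 0 T →
      ∀ᵐ t, t ∈ uIcc 0 T → deriv (fun t => c + ∫ s in (0 : ℝ)..t, γ s) t = γ t := by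
    intro c γ hγ
    filter_upwards [hγ.ae_hasDerivAt_integral] with t ht htm
    exact ((ht htm 0 left_mem_uIcc).const_add c).deriv
  have key := (hprim (c := a 0) hα).integral_deriv_mul_eq_sub (hprim (c := b 0) hβ)
  rw [← ha T ⟨hT, le_rfl⟩, ← hb T ⟨hT, le_rfl⟩] at key
  simp only [intervalIntegral.integral_same, add_zero] at key
  rw [← key]
  refine intervalIntegral.integral_congr_ae ?_
  filter_upwards [hder (c := a 0) hα, hder (c := b 0) hβ] with t h1 h2 ht
  have ht' : t ∈ uIcc 0 T := uIoc_subset_uIcc ht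
  have ht'' : t ∈ Icc 0 T := by rwa [uIcc_of_le hT] at ht'
  rw [h1 ht', h2 ht', ha t ht'', hb t ht'']

theorem eq_add_integral_of_hasDerivWithinAt {x ψ : ℝ → ℝ} {T : ℝ}
    (hψ : ContinuousOn ψ (Icc 0 T))
    (hx : ∀ t ∈ Icc 0 T, HasDerivWithinAt x (ψ t) (Icc 0 T) t) :
    ∀ t ∈ Icc 0 T, x t = x 0 + ∫ s in (0 : ℝ)..t, ψ s := by
  intro t ht
  have hsub : Icc 0 t ⊆ Icc 0 T := Icc_subset_Icc le_rfl ht.2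
  rw [intervalIntegral.integral_eq_sub_of_hasDerivAt_of_le ht.1
    (fun s hs => ((hx s (hsub hs)).continuousWithinAt).mono hsub)
    (fun s hs => (hx s (hsub (Ioo_subset_Icc_self hs))).hasDerivAt
      (Icc_mem_nhds hs.1 (hs.2.trans_le ht.2)))]
  · ring
  · exact (hψ.mono (by rw [uIcc_of_le ht.1]; exact hsub)).intervalIntegrable

/-- A primitive of an integrand that has a continuous representative is differentiable
everywhere, including one-sidedly at the end points. -/
theorem hasDerivWithinAt_of_eq_add_integral {x φ ψ : ℝ → ℝ} {T c : ℝ}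
    (hψ : ContinuousOn ψ (Icc 0 T)) (hφ : φ =ᵐ[volume.restrict (Icc 0 T)] ψ)
    (hx : ∀ t ∈ Icc 0 T, x t = c + ∫ s in (0 : ℝ)..t, φ s) :
    ∀ t ∈ Icc 0 T, HasDerivWithinAt x (ψ t) (Icc 0 T) t := by
  intro t ht
  have hT : 0 ≤ T := ht.1.trans ht.2
  have h0 : (0 : ℝ) ∈ Icc 0 T := ⟨le_rfl, hT⟩
  have key := ODE.hasDerivWithinAt_picard_Icc (f := fun s _ => ψ s) (α := fun _ => (0 : ℝ))
    (u := univ) h0 (hψ.comp continuousOn_fst (fun p hp => hp.1)) continuousOn_const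
    (fun _ _ => mem_univ _) c ht
  refine key.congr_of_mem (fun s hs => ?_) ht
  rw [hx s hs, ODE.picard_apply]
  congr 1
  refine intervalIntegral.integral_congr_ae ?_
  rw [Filter.EventuallyEq, ae_restrict_iff' measurableSet_Icc] at hφ
  filter_upwards [hφ] with r hr hrs
  rw [uIoc_of_le hs.1] at hrs
  exact hr ⟨hrs.1.le, hrs.2.trans hs.2⟩

/-- The sum pairing is controlled by the supremum norms. -/
theorem abs_sum_mul_le {V : Type*} [Fintype V] (a b : V → ℝ) :
    |∑ i, a i * b i| ≤ Fintype.card V * (‖a‖ * ‖b‖) := by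
  refine (Finset.abs_sum_le_sum_abs _ _).trans ?_
  have : ∀ i ∈ (Finset.univ : Finset V), |a i * b i| ≤ ‖a‖ * ‖b‖ := fun i _ => by
    rw [abs_mul]
    exact mul_le_mul (norm_le_pi_norm a i) (norm_le_pi_norm b i) (abs_nonneg _) (norm_nonneg _)
  simpa using Finset.sum_le_card_nsmul _ _ _ this

end Calculus

/-! ### Convex potentials on the simplex -/

section Convexity

variable {V : Type*} [Fintype V]

/-- The gradient inequality for a convex function on the simplex. -/
theorem IsFirstVariation.add_le {F : (V → ℝ) → ℝ} {f : (V → ℝ) → V → ℝ}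
    (hF : ConvexOn ℝ (stdSimplex ℝ V) F) (hf : IsFirstVariation F f) {x y : V → ℝ}
    (hx : x ∈ openSimplex V) (hy : y ∈ stdSimplex ℝ V) :
    F x + ∑ i, f x i * (y i - x i) ≤ F y := by
  -- restrict to the segment `t ↦ x + t (y - x)` and compare slopes at `0` with the chord
  set L : ℝ → V → ℝ := fun t => x + t • (y - x) with hL
  have hmaps : MapsTo L (Icc 0 1) (stdSimplex ℝ V) := fun t ht =>
    (convex_stdSimplex ℝ V).add_smul_sub_mem hx.1 hy ht
  have hLd : HasDerivWithinAt L (y - x) (Icc 0 1) 0 := by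
    have := (((hasDerivAt_id (0 : ℝ)).smul_const (y - x)).const_add x).hasDerivWithinAt
      (s := Icc 0 1)
    rwa [one_smul] at this
  have hfx := hf x hx
  have hL0 : L 0 = x := by simp [hL]
  rw [← hL0] at hfx
  have hd := hfx.comp_hasDerivWithinAt (0 : ℝ) hLd hmaps
  have hle : ∀ t ∈ Ioc (0 : ℝ) 1, (F (L t) - F x) / t ≤ F y - F x := by
    intro t ht
    rw [div_le_iff₀ ht.1]
    have h := hF.2 hx.1 hy (sub_nonneg.2 ht.2) ht.1.le (by ring)
    have e : (1 - t) • x + t • y = L t := by simp only [hL]; module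
    rw [e, smul_eq_mul, smul_eq_mul] at h
    linarith
  have hslope := hasDerivWithinAt_iff_tendsto_slope.1 hd
  have hval : (∑ i, f (L 0) i • (ContinuousLinearMap.proj i : (V → ℝ) →L[ℝ] ℝ)) (y - x)
      = ∑ i, f x i * (y i - x i) := by
    simp [hL0]
  rw [hval] at hslope
  have hne : (𝓝[Icc (0 : ℝ) 1 \ {0}] 0).NeBot := by
    rw [Icc_sdiff_left]
    exact left_nhdsWithin_Ioc_neBot one_pos
  have := le_of_tendsto hslope (b := F y - F x) ?_
  · linarith
  · filter_upwards [self_mem_nhdsWithin] with t ht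
    have ht' : t ∈ Ioc (0 : ℝ) 1 := by rwa [Icc_sdiff_left] at ht
    have := hle t ht'
    simp only [slope_def_field, Function.comp, sub_zero, hL0]
    exact this

theorem IsFirstVariation.monotone {F : (V → ℝ) → ℝ} {f : (V → ℝ) → V → ℝ}
    (hF : ConvexOn ℝ (stdSimplex ℝ V) F) (hf : IsFirstVariation F f) {x y : V → ℝ}
    (hx : x ∈ openSimplex V) (hy : y ∈ openSimplex V) :
    0 ≤ ∑ i, (f y i - f x i) * (y i - x i) := by
  have h1 := hf.add_le hF hx hy.1
  have h2 := hf.add_le hF hy hx.1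
  have e : ∑ i, (f y i - f x i) * (y i - x i)
      = -(∑ i, f x i * (y i - x i)) - ∑ i, f y i * (x i - y i) := by
    rw [← Finset.sum_neg_distrib, ← Finset.sum_sub_distrib]
    exact Finset.sum_congr rfl fun i _ => by ring
  rw [e]; linarith

theorem IsFirstVariation.continuousOn_comp {F : (V → ℝ) → ℝ} {f : (V → ℝ) → V → ℝ}
    (hf : IsFirstVariation F f) {ρ : ℝ → V → ℝ} {s : Set ℝ} (hρ : ContinuousOn ρ s)
    (hmem : ∀ t ∈ s, ρ t ∈ openSimplex V) : ContinuousOn (fun t => F (ρ t)) s := fun t ht =>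
  ((hf _ (hmem t ht)).continuousWithinAt).comp (hρ t ht) fun u hu => (hmem u hu).1

end Convexity

/-! ### Trajectories and the convexity of the action -/

section Trajectory

variable {V : Type*} [Fintype V] {Γ : SimpleGraph V} [DecidableRel Γ.Adj] {w : V → V → ℝ}
  {f : (V → ℝ) → V → ℝ} {T : ℝ} {ρ S : ℝ → V → ℝ}

theorem continuousOn_densityRate {s : Set ℝ} (hρ : ContinuousOn ρ s) (hS : ContinuousOn S s)
    (i : V) : ContinuousOn (fun t => densityRate Γ w (ρ t) (S t) i) s := by
  have h1 : ∀ i, ContinuousOn (fun t => ρ t i) s := continuousOn_pi.1 hρ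
  have h2 : ∀ i, ContinuousOn (fun t => S t i) s := continuousOn_pi.1 hS
  simp only [densityRate, theta]
  fun_prop

theorem continuousOn_valueRate {s : Set ℝ} (hS : ContinuousOn S s)
    (i : V) : ContinuousOn (fun t => valueRate Γ w (S t) i) s := by
  have h2 : ∀ i, ContinuousOn (fun t => S t i) s := continuousOn_pi.1 hS
  simp only [valueRate]
  fun_prop

theorem SolvesCoupledSystem.continuousOn_density (h : SolvesCoupledSystem Γ w f T ρ S) :
    ContinuousOn ρ (Icc 0 T) :=
  continuousOn_pi.2 fun i t ht => (h.continuity t ht i).continuousWithinAt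

theorem SolvesCoupledSystem.continuousOn_value (h : SolvesCoupledSystem Γ w f T ρ S) :
    ContinuousOn S (Icc 0 T) :=
  continuousOn_pi.2 fun i t ht => (h.hamiltonJacobi t ht i).continuousWithinAt

theorem SolvesCoupledSystem.continuousOn_firstVariation (h : SolvesCoupledSystem Γ w f T ρ S)
    (hf : ContinuousOn f (openSimplex V)) (i : V) :
    ContinuousOn (fun t => f (ρ t) i) (Icc 0 T) :=
  continuousOn_pi.1 (hf.comp h.continuousOn_density h.mem_openSimplex) i

theorem continuousOn_kinetic_velocity (hw : ∀ i j, Γ.Adj i j → 0 < w i j) {s : Set ℝ}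
    (hρ : ContinuousOn ρ s) (hS : ContinuousOn S s) :
    ContinuousOn (fun t => kinetic Γ (ρ t) (velocity Γ w (S t))) s := by
  have h1 : ∀ i, ContinuousOn (fun t => ρ t i) s := continuousOn_pi.1 hρ
  have h2 : ∀ i, ContinuousOn (fun t => S t i) s := continuousOn_pi.1 hS
  simp only [kinetic_velocity Γ hw, theta]
  fun_prop

/-- A trajectory of the coupled system, with its induced velocity field, is a competitor in the
path-wise problem. -/
theorem SolvesCoupledSystem.isPWAdmissible (hw_symm : ∀ i j, w i j = w j i)
    (hw : ∀ i j, Γ.Adj i j → 0 < w i j) (hT : 0 ≤ T) {F : (V → ℝ) → ℝ}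
    (hf : IsFirstVariation F f) (h : SolvesCoupledSystem Γ w f T ρ S) :
    IsPWAdmissible Γ w F (ρ 0) T ρ (fun t => velocity Γ w (S t)) where
  mem_simplex t ht := (h.mem_openSimplex t ht).1
  vectorField t _ := isVectorField_velocity Γ hw_symm _
  measurable i j := by
    by_cases hij : Γ.Adj i j
    · have h2 : ∀ i, ContinuousOn (fun t => S t i) (Icc 0 T) :=
        continuousOn_pi.1 h.continuousOn_value
      have : ContinuousOn (fun t => velocity Γ w (S t) i j) (Icc 0 T) := by
        simp only [velocity, hij, if_true]
        fun_prop
      exact this.aemeasurable measurableSet_Icc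
    · simp [velocity, hij]
  kinetic_integrable := ((continuousOn_kinetic_velocity hw h.continuousOn_density
    h.continuousOn_value).mono (by rw [uIcc_of_le hT])).intervalIntegrable
  potential_integrable := ((hf.continuousOn_comp h.continuousOn_density
    h.mem_openSimplex).mono (by rw [uIcc_of_le hT])).intervalIntegrable
  flux_integrable i := by
    simp only [divG_velocity Γ hw]
    exact ((continuousOn_densityRate h.continuousOn_density h.continuousOn_value i).neg.mono
      (by rw [uIcc_of_le hT])).intervalIntegrable
  continuity t ht i := by
    simp only [divG_velocity Γ hw, intervalIntegral.integral_neg, sub_neg_eq_add]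
    exact eq_add_integral_of_hasDerivWithinAt
      (continuousOn_densityRate h.continuousOn_density h.continuousOn_value i)
      (fun t ht => h.continuity t ht i) t ht

theorem costIV_eq_costPW (hw : ∀ i j, Γ.Adj i j → 0 < w i j) (F G : (V → ℝ) → ℝ) :
    costIV Γ w F G T ρ S = costPW Γ F G T ρ (fun t => velocity Γ w (S t)) := by
  simp only [costIV, costPW, kinetic_velocity Γ hw, Finset.mul_sum]

/-- Pointwise form of the convexity of the Lagrangian in density and flux. The left-hand side is
the excess of the running cost over its linearization; it is bounded below by
`∑ (v'_ij + √w_ij (S_i - S_j))² θ_ij(ρ') / 4`. -/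
theorem lagrangian_gap_nonneg (hw_symm : ∀ i j, w i j = w j i)
    (hw : ∀ i j, Γ.Adj i j → 0 < w i j) {F : (V → ℝ) → ℝ}
    (hF : ConvexOn ℝ (stdSimplex ℝ V) F) (hf : IsFirstVariation F f)
    {r s r' : V → ℝ} {v' : V → V → ℝ} (hr : r ∈ openSimplex V) (hr' : r' ∈ stdSimplex ℝ V)
    (hv' : IsVectorField Γ v') :
    0 ≤ (kinetic Γ r' v' + F r') - (kinetic Γ r (velocity Γ w s) + F r)
      + ∑ i, ((valueRate Γ w s i - f r i) * (r' i - r i)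
        + s i * (-divG Γ w r' v' i - densityRate Γ w r s i)) := by
  have e : ∑ i, ((valueRate Γ w s i - f r i) * (r' i - r i)
        + s i * (-divG Γ w r' v' i - densityRate Γ w r s i))
      = ∑ i, (r' i - r i) * valueRate Γ w s i - ∑ i, f r i * (r' i - r i)
        - ∑ i, s i * divG Γ w r' v' i - ∑ i, s i * densityRate Γ w r s i := by
    simp only [← Finset.sum_sub_distrib]
    exact Finset.sum_congr rfl fun i _ => by ring
  have h1 := hf.add_le hF hr hr'
  rw [e, sum_mul_valueRate Γ hw_symm, sum_mul_divG Γ hw_symm hv'.1,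
    sum_mul_densityRate Γ hw_symm, kinetic_eq, kinetic_velocity Γ hw]
  have key : 0 ≤ ∑ i, ∑ j ∈ Γ.neighborFinset i,
      (v' i j + Real.sqrt (w i j) * (s i - s j)) ^ 2 * theta r' i j :=
    Finset.sum_nonneg fun i _ => Finset.sum_nonneg fun j _ =>
      mul_nonneg (sq_nonneg _) (by
        have := hr'.1 i; have := hr'.1 j; simp only [theta]; positivity)
  have e2 : ∑ i, ∑ j ∈ Γ.neighborFinset i,
      (v' i j + Real.sqrt (w i j) * (s i - s j)) ^ 2 * theta r' i j
      = ∑ i, ∑ j ∈ Γ.neighborFinset i, v' i j ^ 2 * theta r' i j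
        + 2 * ∑ i, ∑ j ∈ Γ.neighborFinset i,
          (s i - s j) * (Real.sqrt (w i j) * v' i j * theta r' i j)
        + ∑ i, ∑ j ∈ Γ.neighborFinset i, w i j * (s i - s j) ^ 2
            * theta (fun i => r' i - r i) i j
        + ∑ i, ∑ j ∈ Γ.neighborFinset i, w i j * (s i - s j) ^ 2 * theta r i j := by
    simp only [Finset.mul_sum, ← Finset.sum_add_distrib]
    refine Finset.sum_congr rfl fun i _ => Finset.sum_congr rfl fun j hj => ?_
    have hij : Γ.Adj i j := by simpa using hj
    have := Real.sq_sqrt (hw i j hij).le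
    rw [theta_sub]
    linear_combination ((s i - s j) ^ 2 * theta r' i j) * this
  have e3 : ∑ i, ∑ j ∈ Γ.neighborFinset i, w i j * (s i - s j) * (s i - s j) * theta r i j
      = ∑ i, ∑ j ∈ Γ.neighborFinset i, w i j * (s i - s j) ^ 2 * theta r i j :=
    Finset.sum_congr rfl fun i _ => Finset.sum_congr rfl fun j _ => by ring
  rw [e3]
  linarith

/-- The convexity inequality behind the sufficiency of the Nash system: a trajectory of the
coupled system minimizes the action up to the boundary terms produced by `S`. -/
theorem SolvesCoupledSystem.action_le (hw_symm : ∀ i j, w i j = w j i)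
    (hw : ∀ i j, Γ.Adj i j → 0 < w i j) (hT : 0 ≤ T) {F : (V → ℝ) → ℝ}
    (hF : ConvexOn ℝ (stdSimplex ℝ V) F) (hf : IsFirstVariation F f)
    (hfc : ContinuousOn f (openSimplex V))
    (h : SolvesCoupledSystem Γ w f T ρ S) {ρ' : ℝ → V → ℝ} {v' : ℝ → V → V → ℝ}
    (h' : IsPWAdmissible Γ w F (ρ 0) T ρ' v') :
    (∫ t in (0 : ℝ)..T, (kinetic Γ (ρ t) (velocity Γ w (S t)) + F (ρ t)))
      ≤ (∫ t in (0 : ℝ)..T, (kinetic Γ (ρ' t) (v' t) + F (ρ' t)))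
        + ∑ i, S T i * (ρ' T i - ρ T i) := by
  have hadm := h.isPWAdmissible hw_symm hw hT hf
  have h0 : (0 : ℝ) ∈ Icc 0 T := ⟨le_rfl, hT⟩
  have hρ'0 : ∀ i, ρ' 0 i = ρ 0 i := fun i => by simpa using h'.continuity 0 h0 i
  have hIS : ∀ i, IntervalIntegrable (fun t => valueRate Γ w (S t) i - f (ρ t) i) volume 0 T :=
    fun i => (((continuousOn_valueRate h.continuousOn_value i).sub
      (h.continuousOn_firstVariation hfc i)).mono (by rw [uIcc_of_le hT])).intervalIntegrable
  have hIρ : ∀ i, IntervalIntegrable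
      (fun t => densityRate Γ w (ρ t) (S t) i) volume 0 T := fun i =>
    ((continuousOn_densityRate h.continuousOn_density h.continuousOn_value i).mono
      (by rw [uIcc_of_le hT])).intervalIntegrable
  have hIδ : ∀ i, IntervalIntegrable (fun t => -divG Γ w (ρ' t) (v' t) i
      - densityRate Γ w (ρ t) (S t) i) volume 0 T := fun i =>
    (h'.flux_integrable i).neg.sub (hIρ i)
  have hprimS : ∀ i, ∀ t ∈ Icc 0 T, S t i = S 0 i
      + ∫ s in (0 : ℝ)..t, (valueRate Γ w (S s) i - f (ρ s) i) := fun i =>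
    eq_add_integral_of_hasDerivWithinAt
      ((continuousOn_valueRate h.continuousOn_value i).sub
        (h.continuousOn_firstVariation hfc i)) (fun t ht => h.hamiltonJacobi t ht i)
  have hsub : ∀ t ∈ Icc 0 T, uIcc 0 t ⊆ uIcc 0 T := fun t ht => by
    rw [uIcc_of_le ht.1, uIcc_of_le hT]; exact Icc_subset_Icc le_rfl ht.2
  have hprimδ : ∀ i, ∀ t ∈ Icc 0 T, ρ' t i - ρ t i = (ρ' 0 i - ρ 0 i)
      + ∫ s in (0 : ℝ)..t, (-divG Γ w (ρ' s) (v' s) i - densityRate Γ w (ρ s) (S s) i) := by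
    intro i t ht
    have hneg : IntervalIntegrable (fun t => -divG Γ w (ρ' t) (v' t) i) volume 0 t :=
      (h'.flux_integrable i).neg.mono_set (hsub t ht)
    rw [intervalIntegral.integral_sub hneg ((hIρ i).mono_set (hsub t ht)), intervalIntegral.integral_neg, h'.continuity t ht i,
      eq_add_integral_of_hasDerivWithinAt
      (continuousOn_densityRate h.continuousOn_density h.continuousOn_value i)
      (fun t ht => h.continuity t ht i) t ht, hρ'0]
    ring
  have hparts := fun i => integral_by_parts_of_primitive hT (hIS i) (hIδ i) (hprimS i) (hprimδ i)
  have hcδ : ∀ i, ContinuousOn (fun t => ρ' t i - ρ t i) (uIcc 0 T) := fun i => by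
    have := intervalIntegral.continuousOn_primitive_interval' (hIδ i) (left_mem_uIcc)
    refine (continuousOn_const.add this).congr (g := fun t => ρ' t i - ρ t i)
      (f := fun t => (ρ' 0 i - ρ 0 i) + _) fun t ht => ?_
    rw [uIcc_of_le hT] at ht
    exact hprimδ i t ht
  have hcS : ∀ i, ContinuousOn (fun t => S t i) (uIcc 0 T) := fun i => by
    rw [uIcc_of_le hT]; exact continuousOn_pi.1 h.continuousOn_value i
  have hIi : ∀ i, IntervalIntegrable (fun t => (valueRate Γ w (S t) i - f (ρ t) i)
      * (ρ' t i - ρ t i) + S t i * (-divG Γ w (ρ' t) (v' t) i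
      - densityRate Γ w (ρ t) (S t) i)) volume 0 T := fun i =>
    ((hIS i).mul_continuousOn (hcδ i)).add ((hIδ i).continuousOn_mul (hcS i))
  have hIL' := h'.kinetic_integrable.add h'.potential_integrable
  have hIL := hadm.kinetic_integrable.add hadm.potential_integrable
  have hIsum := IntervalIntegrable.sum (Finset.univ : Finset V) (fun i _ => hIi i)
  have hnn : 0 ≤ ∫ t in (0 : ℝ)..T, ((kinetic Γ (ρ' t) (v' t) + F (ρ' t))
      - (kinetic Γ (ρ t) (velocity Γ w (S t)) + F (ρ t))
      + ∑ i, ((valueRate Γ w (S t) i - f (ρ t) i) * (ρ' t i - ρ t i)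
        + S t i * (-divG Γ w (ρ' t) (v' t) i - densityRate Γ w (ρ t) (S t) i))) :=
    intervalIntegral.integral_nonneg hT fun t ht =>
      lagrangian_gap_nonneg hw_symm hw hF hf (h.mem_openSimplex t ht) (h'.mem_simplex t ht)
        (h'.vectorField t ht)
  have hIsum' : IntervalIntegrable (fun t => ∑ i, ((valueRate Γ w (S t) i - f (ρ t) i)
      * (ρ' t i - ρ t i) + S t i * (-divG Γ w (ρ' t) (v' t) i
      - densityRate Γ w (ρ t) (S t) i))) volume 0 T := by
    rw [← Finset.sum_fn]; exact hIsum
  rw [intervalIntegral.integral_add (hIL'.sub hIL) hIsum', intervalIntegral.integral_sub hIL' hIL,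
    intervalIntegral.integral_finsetSum (fun i _ => hIi i),
    Finset.sum_congr rfl (fun i _ => hparts i)] at hnn
  simp only [hρ'0, sub_self, mul_zero, sub_zero] at hnn
  linarith

end Trajectory

/-! ### Perturbation of solutions of ordinary differential equations -/

section Flow

variable {E F : Type*} [NormedAddCommGroup E] [NormedSpace ℝ E] [FiniteDimensional ℝ E]
  [NormedAddCommGroup F] [NormedSpace ℝ F]

/-- A `C¹` map on an open set agrees near a given compact subset with a compactly supported
`C¹` map, which is therefore globally bounded and Lipschitz. -/
theorem exists_contDiff_cutoff {X : E → F} {U K : Set E} (hU : IsOpen U)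
    (hX : ContDiffOn ℝ 1 X U) (hK : IsCompact K) (hKU : K ⊆ U) :
    ∃ Y : E → F, ContDiff ℝ 1 Y ∧ HasCompactSupport Y ∧
      ∃ δ > 0, Metric.thickening δ K ⊆ U ∧ EqOn Y X (Metric.thickening δ K) := by
  obtain ⟨L, hL, hKL, hLU⟩ := exists_compact_between hK hU hKU
  obtain ⟨χ, hχ1, hχ0, -⟩ := exists_contMDiffMap_one_nhds_of_subset_interior
    (n := 1) (modelWithCornersSelf ℝ E) hK.isClosed hKL
  have hχ : ContDiff ℝ 1 (χ : E → ℝ) := χ.contMDiff.contDiff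
  have hout : ∀ x ∉ L, χ x • X x = 0 := fun x hx => by rw [hχ0 x hx, zero_smul]
  obtain ⟨δ₁, hδ₁, h1⟩ := (Filter.HasBasis.mem_iff (Metric.hasBasis_nhdsSet_thickening hK)).1 hχ1
  obtain ⟨δ₂, hδ₂, h2⟩ := hK.exists_thickening_subset_open hU hKU
  refine ⟨fun x => χ x • X x, ?_, HasCompactSupport.intro hL hout, min δ₁ δ₂, lt_min hδ₁ hδ₂,
    (Metric.thickening_mono (min_le_right _ _) _).trans h2, fun x hx => ?_⟩
  · rw [contDiff_iff_contDiffAt]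
    intro x
    by_cases hx : x ∈ L
    · exact hχ.contDiffAt.smul (hX.contDiffAt (hU.mem_nhds (hLU hx)))
    · refine (contDiffAt_const (c := (0 : F))).congr_of_eventuallyEq ?_
      filter_upwards [hL.isClosed.isOpen_compl.mem_nhds hx] with y hy using hout y hy
  · have : χ x = 1 := h1 (Metric.thickening_mono (min_le_left _ _) _ hx)
    simp [this]

/-- Grönwall's inequality for two solutions on `[0, T]`, with a constant uniform in time. -/
theorem dist_le_exp_of_hasDerivWithinAt {E : Type*} [NormedAddCommGroup E] [NormedSpace ℝ E]
    {Y : E → E} {L : NNReal} (hY : LipschitzWith L Y) {T : ℝ}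
    {y z : ℝ → E} (hy : ∀ t ∈ Icc 0 T, HasDerivWithinAt y (Y (y t)) (Icc 0 T) t)
    (hz : ∀ t ∈ Icc 0 T, HasDerivWithinAt z (Y (z t)) (Icc 0 T) t) :
    ∀ t ∈ Icc 0 T, ‖z t - y t‖ ≤ ‖z 0 - y 0‖ * Real.exp (L * T) := by
  intro t ht
  have hright : ∀ {x : ℝ → E}, (∀ t ∈ Icc 0 T, HasDerivWithinAt x (Y (x t)) (Icc 0 T) t) →
      ∀ t ∈ Ico 0 T, HasDerivWithinAt x (Y (x t)) (Ici t) t := fun hx t ht =>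
    (hx t (Ico_subset_Icc_self ht)).mono_of_mem_nhdsWithin
      (mem_of_superset (Icc_mem_nhdsGE ht.2) (Icc_subset_Icc ht.1 le_rfl))
  have := dist_le_of_trajectories_ODE (v := fun _ => Y) (K := L) (fun _ => hY)
    (fun t ht => (hz t ht).continuousWithinAt) (hright hz)
    (fun t ht => (hy t ht).continuousWithinAt) (hright hy) le_rfl t ht
  rw [dist_eq_norm, dist_eq_norm] at this
  refine this.trans (mul_le_mul_of_nonneg_left ?_ (norm_nonneg _))
  rw [sub_zero]
  exact Real.exp_le_exp.2 (mul_le_mul_of_nonneg_left ht.2 L.2)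

theorem eqOn_of_hasDerivWithinAt {X : E → E} {U : Set E} (hU : IsOpen U)
    (hX : ContDiffOn ℝ 1 X U) {T : ℝ} {y z : ℝ → E} (hyU : ∀ t ∈ Icc 0 T, y t ∈ U)
    (hzU : ∀ t ∈ Icc 0 T, z t ∈ U)
    (hy : ∀ t ∈ Icc 0 T, HasDerivWithinAt y (X (y t)) (Icc 0 T) t)
    (hz : ∀ t ∈ Icc 0 T, HasDerivWithinAt z (X (z t)) (Icc 0 T) t) (h0 : z 0 = y 0) :
    EqOn z y (Icc 0 T) := by
  have hcy : ContinuousOn y (Icc 0 T) := fun t ht => (hy t ht).continuousWithinAt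
  have hcz : ContinuousOn z (Icc 0 T) := fun t ht => (hz t ht).continuousWithinAt
  have hK : IsCompact (y '' Icc 0 T ∪ z '' Icc 0 T) :=
    (isCompact_Icc.image_of_continuousOn hcy).union (isCompact_Icc.image_of_continuousOn hcz)
  obtain ⟨Y, hY, hYs, δ, hδ, -, hYX⟩ := exists_contDiff_cutoff hU hX hK (by
    rintro _ (⟨t, ht, rfl⟩ | ⟨t, ht, rfl⟩)
    exacts [hyU t ht, hzU t ht])
  obtain ⟨L, hL⟩ := hY.lipschitzWith_of_hasCompactSupport hYs one_ne_zero
  have hmem := Metric.self_subset_thickening hδ (y '' Icc 0 T ∪ z '' Icc 0 T)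
  intro t ht
  have := dist_le_exp_of_hasDerivWithinAt hL (y := y) (z := z) (T := T)
    (fun t ht => by rw [hYX (hmem (Or.inl ⟨t, ht, rfl⟩))]; exact hy t ht)
    (fun t ht => by rw [hYX (hmem (Or.inr ⟨t, ht, rfl⟩))]; exact hz t ht) t ht
  rw [h0, sub_self, norm_zero, zero_mul] at this
  exact sub_eq_zero.1 (norm_le_zero_iff.1 this)

/-- Solutions of an autonomous `C¹` equation persist on the whole time interval under small
perturbations of the initial value, with Lipschitz dependence of solution and velocity. -/
theorem exists_nearby_solution {X : E → E} {U : Set E} (hU : IsOpen U)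
    (hX : ContDiffOn ℝ 1 X U) {T : ℝ} (hT : 0 ≤ T) {y : ℝ → E} (hyU : ∀ t ∈ Icc 0 T, y t ∈ U)
    (hy : ∀ t ∈ Icc 0 T, HasDerivWithinAt y (X (y t)) (Icc 0 T) t) :
    ∃ δ > 0, ∃ C > 0, ∀ x, ‖x - y 0‖ ≤ δ → ∃ z : ℝ → E, z 0 = x ∧
      ∀ t ∈ Icc 0 T, z t ∈ U ∧ HasDerivWithinAt z (X (z t)) (Icc 0 T) t ∧
        ‖z t - y t‖ ≤ C * ‖x - y 0‖ ∧ ‖X (z t) - X (y t)‖ ≤ C * ‖x - y 0‖ := by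
  have hcy : ContinuousOn y (Icc 0 T) := fun t ht => (hy t ht).continuousWithinAt
  have hK : IsCompact (y '' Icc 0 T) := isCompact_Icc.image_of_continuousOn hcy
  obtain ⟨Y, hY, hYs, δ, hδ, hδU, hYX⟩ := exists_contDiff_cutoff hU hX hK (by
    rintro _ ⟨t, ht, rfl⟩; exact hyU t ht)
  obtain ⟨L, hL⟩ := hY.lipschitzWith_of_hasCompactSupport hYs one_ne_zero
  obtain ⟨M, hM⟩ := hYs.exists_bound_of_continuous hY.continuous
  have hM0 : 0 ≤ M := (norm_nonneg _).trans (hM (y 0))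
  have hmem : ∀ t ∈ Icc 0 T, y t ∈ Metric.thickening δ (y '' Icc 0 T) := fun t ht =>
    Metric.self_subset_thickening hδ _ ⟨t, ht, rfl⟩
  set c := Real.exp (L * T) with hc
  have hc0 : 0 < c := Real.exp_pos _
  refine ⟨δ / (2 * c), by positivity, (L + 1) * c, by positivity, fun x hx => ?_⟩
  -- the cut-off field is bounded, so the Picard–Lindelöf ball can be taken as large as needed
  have hPL : IsPicardLindelof (fun _ => Y) (⟨0, le_rfl, hT⟩ : Icc 0 T) x
      (M.toNNReal * T.toNNReal) 0 M.toNNReal L :=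
    IsPicardLindelof.of_time_independent
      (fun x _ => by rw [Real.coe_toNNReal _ hM0]; exact hM x) hL.lipschitzOnWith (by
        simp [hT])
  obtain ⟨z, hz0, hz⟩ := hPL.exists_eq_forall_mem_Icc_hasDerivWithinAt₀
  have hyY : ∀ t ∈ Icc 0 T, HasDerivWithinAt y (Y (y t)) (Icc 0 T) t := fun t ht => by
    rw [hYX (hmem t ht)]; exact hy t ht
  have hclose := dist_le_exp_of_hasDerivWithinAt hL hyY hz
  rw [show z 0 = x from hz0] at hclose
  refine ⟨z, hz0, fun t ht => ?_⟩
  have hzt := hclose t ht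
  have hzmem : z t ∈ Metric.thickening δ (y '' Icc 0 T) := by
    rw [Metric.mem_thickening_iff]
    refine ⟨y t, ⟨t, ht, rfl⟩, ?_⟩
    rw [dist_eq_norm]
    have h1 : ‖x - y 0‖ * c ≤ δ / (2 * c) * c := mul_le_mul_of_nonneg_right hx hc0.le
    have h2 : δ / (2 * c) * c = δ / 2 := by field_simp
    linarith
  have hn := norm_nonneg (x - y 0)
  have hL0 : (0 : ℝ) ≤ L := L.2
  refine ⟨hδU hzmem, by rw [← hYX hzmem]; exact hz t ht, ?_, ?_⟩
  · have : 0 ≤ L * (‖x - y 0‖ * c) := by positivity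
    linarith
  · rw [← hYX hzmem, ← hYX (hmem t ht)]
    have h1 := hL.norm_sub_le (z t) (y t)
    have h2 := mul_le_mul_of_nonneg_left hzt hL0
    have : 0 ≤ ‖x - y 0‖ * c := by positivity
    linarith

/-- Version of `exists_nearby_solution` with the value prescribed at the final time. -/
theorem exists_nearby_solution_backward {X : E → E} {U : Set E} (hU : IsOpen U)
    (hX : ContDiffOn ℝ 1 X U) {T : ℝ} (hT : 0 ≤ T) {y : ℝ → E} (hyU : ∀ t ∈ Icc 0 T, y t ∈ U)
    (hy : ∀ t ∈ Icc 0 T, HasDerivWithinAt y (X (y t)) (Icc 0 T) t) :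
    ∃ δ > 0, ∃ C > 0, ∀ x, ‖x - y T‖ ≤ δ → ∃ z : ℝ → E, z T = x ∧
      ∀ t ∈ Icc 0 T, z t ∈ U ∧ HasDerivWithinAt z (X (z t)) (Icc 0 T) t ∧
        ‖z t - y t‖ ≤ C * ‖x - y T‖ ∧ ‖X (z t) - X (y t)‖ ≤ C * ‖x - y T‖ := by
  have hrev : ∀ t ∈ Icc 0 T, T - t ∈ Icc 0 T := fun t ht => ⟨by linarith [ht.2], by linarith [ht.1]⟩
  have hflip : ∀ (u : ℝ → E) (t : ℝ) (u' : E), HasDerivWithinAt u u' (Icc 0 T) (T - t) →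
      HasDerivWithinAt (fun s => u (T - s)) (-u') (Icc 0 T) t := by
    intro u t u' hu
    have h1 : HasDerivWithinAt (fun s : ℝ => T - s) (-1) (Icc 0 T) t :=
      ((hasDerivAt_id t).const_sub T).hasDerivWithinAt
    simpa [Function.comp_def] using hu.scomp t h1 hrev
  obtain ⟨δ, hδ, C, hC, H⟩ := exists_nearby_solution (X := fun x => -X x) hU hX.neg hT
    (y := fun t => y (T - t)) (fun t ht => hyU _ (hrev t ht))
    (fun t ht => hflip y t _ (hy _ (hrev t ht)))
  simp only [sub_zero] at H
  refine ⟨δ, hδ, C, hC, fun x hx => ?_⟩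
  obtain ⟨z, hz0, hz⟩ := H x hx
  refine ⟨fun t => z (T - t), by simpa using hz0, fun t ht => ?_⟩
  obtain ⟨h1, h2, h3, h4⟩ := hz _ (hrev t ht)
  refine ⟨h1, ?_, by simpa using h3, ?_⟩
  · simpa using hflip z t _ h2
  · have e : -X (z (T - t)) - -X (y (T - (T - t))) = -(X (z (T - t)) - X (y t)) := by
      rw [sub_sub_cancel]; abel
    rwa [e, norm_neg] at h4

end Flow

/-! ### Extension of the first variation off the simplex -/

section Extension

variable {V : Type*} [Fintype V]

/-- Projection of `ℝ^V` onto the hyperplane of densities of total mass one, along the constants. -/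
def massProj (x : V → ℝ) : V → ℝ := fun i => x i + (1 - ∑ j, x j) / Fintype.card V

/-- The linear part of `massProj`: projection onto the vectors of total mass zero. -/
def meanProj : (V → ℝ) →L[ℝ] (V → ℝ) :=
  ContinuousLinearMap.pi fun i => (ContinuousLinearMap.proj i : (V → ℝ) →L[ℝ] ℝ)
    - (1 / Fintype.card V : ℝ) • ∑ j, (ContinuousLinearMap.proj j : (V → ℝ) →L[ℝ] ℝ)

/-- The open set of vectors in `ℝ^V` that `massProj` maps to positive densities. -/
def massDomain (V : Type*) [Fintype V] : Set (V → ℝ) := {x | ∀ i, 0 < massProj x i}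

theorem meanProj_apply (x : V → ℝ) (i : V) :
    meanProj x i = x i - (1 / Fintype.card V) * ∑ j, x j := by
  simp [meanProj]

theorem meanProj_of_sum_eq_zero {x : V → ℝ} (hx : ∑ i, x i = 0) : meanProj x = x := by
  ext i; simp [meanProj_apply, hx]

theorem massProj_of_sum_eq_one {x : V → ℝ} (hx : ∑ i, x i = 1) : massProj x = x := by
  ext i; simp [massProj, hx]

theorem massProj_eq (x : V → ℝ) :
    massProj x = meanProj x + fun _ => (1 / Fintype.card V : ℝ) := by
  ext i; simp only [massProj, meanProj_apply, Pi.add_apply]; ring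

theorem hasFDerivAt_massProj (x : V → ℝ) : HasFDerivAt massProj (meanProj (V := V)) x := by
  have := (meanProj (V := V)).hasFDerivAt (x := x) |>.add_const (fun _ => (1 / Fintype.card V : ℝ))
  exact this.congr_of_eventuallyEq (Eventually.of_forall massProj_eq)

theorem contDiff_massProj : ContDiff ℝ 1 (massProj : (V → ℝ) → V → ℝ) := by
  rw [show (massProj : (V → ℝ) → V → ℝ) = fun x => meanProj x + fun _ => (1 / Fintype.card V : ℝ)
    from funext massProj_eq]
  exact (meanProj (V := V)).contDiff.add contDiff_const

theorem isOpen_massDomain : IsOpen (massDomain V) := by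
  have : massDomain V = ⋂ i, {x | 0 < massProj x i} := by ext x; simp [massDomain]
  rw [this]
  refine isOpen_iInter_of_finite fun i => isOpen_lt continuous_const ?_
  exact (continuous_apply i).comp (contDiff_massProj (V := V)).continuous

theorem massProj_mem [Nonempty V] {x : V → ℝ} (hx : x ∈ massDomain V) :
    massProj x ∈ openSimplex V := by
  refine ⟨⟨fun i => (hx i).le, ?_⟩, hx⟩
  simp only [massProj, Finset.sum_add_distrib, Finset.sum_const, Finset.card_univ, nsmul_eq_mul]
  have : (Fintype.card V : ℝ) ≠ 0 := by positivity
  field_simp; ring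

theorem openSimplex_subset_massDomain : openSimplex V ⊆ massDomain V := fun x hx i => by
  rw [massProj_of_sum_eq_one hx.1.2]; exact hx.2 i

theorem contDiffOn_comp_massProj [Nonempty V] {f : (V → ℝ) → V → ℝ}
    (hf : ContDiffOn ℝ 1 f (openSimplex V)) :
    ContDiffOn ℝ 1 (fun x => f (massProj x)) (massDomain V) :=
  hf.comp contDiff_massProj.contDiffOn fun _ hx => massProj_mem hx

/-- The derivative of a first variation is symmetric along the simplex, being a second
derivative of the potential. -/
theorem IsFirstVariation.fderiv_symm [Nonempty V] {F : (V → ℝ) → ℝ} {f : (V → ℝ) → V → ℝ}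
    (hf : IsFirstVariation F f) (hf1 : ContDiffOn ℝ 1 f (openSimplex V)) {a : V → ℝ}
    (ha : a ∈ massDomain V) {u v : V → ℝ} (hu : ∑ i, u i = 0) (hv : ∑ i, v i = 0) :
    ∑ i, fderiv ℝ (fun x => f (massProj x)) a u i * v i
      = ∑ i, fderiv ℝ (fun x => f (massProj x)) a v i * u i := by
  set P : V → (V → ℝ) →L[ℝ] ℝ := fun i => ContinuousLinearMap.proj i with hP
  let Ψ : (V → ℝ) →L[ℝ] ((V → ℝ) →L[ℝ] ℝ) := ∑ i, (P i).smulRight ((P i).comp meanProj)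
  have hΨ : ∀ y z, Ψ y z = ∑ i, y i * meanProj z i := fun y z => by simp [Ψ, hP]
  have h1 : ∀ᶠ x in 𝓝 a, HasFDerivAt (fun x => F (massProj x)) (Ψ (f (massProj x))) x := by
    filter_upwards [isOpen_massDomain.mem_nhds ha] with x hx
    have hc := (hf _ (massProj_mem hx)).comp x (hasFDerivAt_massProj x).hasFDerivWithinAt
      (s := massDomain V) (fun z hz => (massProj_mem hz).1)
    have := hc.hasFDerivAt (isOpen_massDomain.mem_nhds hx)
    refine this.congr_fderiv ?_
    ext z
    simp [hΨ]
  have h2 : HasFDerivAt (fun x => Ψ (f (massProj x)))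
      (Ψ.comp (fderiv ℝ (fun x => f (massProj x)) a)) a := by
    have hd : DifferentiableAt ℝ (fun x => f (massProj x)) a :=
      ((contDiffOn_comp_massProj hf1).contDiffAt
        (isOpen_massDomain.mem_nhds ha)).differentiableAt one_ne_zero
    exact Ψ.hasFDerivAt.comp a hd.hasFDerivAt
  have := second_derivative_symmetric_of_eventually h1 h2 u v
  simpa [hΨ, meanProj_of_sum_eq_zero hu, meanProj_of_sum_eq_zero hv] using this

/-- Uniformly on compact sets of densities, the increments of a first variation are symmetric to
second order. -/
theorem IsFirstVariation.exists_increment_symm [Nonempty V] {F : (V → ℝ) → ℝ}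
    {f : (V → ℝ) → V → ℝ} (hf : IsFirstVariation F f) (hf1 : ContDiffOn ℝ 1 f (openSimplex V))
    {K : Set (V → ℝ)} (hK : IsCompact K) (hKs : K ⊆ openSimplex V) {η : ℝ} (hη : 0 < η) :
    ∃ δ > 0, ∀ a ∈ K, ∀ x ∈ openSimplex V, ∀ y ∈ openSimplex V, ‖x - a‖ < δ → ‖y - a‖ < δ →
      |∑ i, (f x i - f a i) * (y i - a i) - ∑ i, (f y i - f a i) * (x i - a i)|
        ≤ η * (‖x - a‖ * ‖y - a‖) := by
  obtain ⟨Y, hY, hYs, δ₀, hδ₀, hδU, hYf⟩ := exists_contDiff_cutoff isOpen_massDomain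
    (contDiffOn_comp_massProj hf1) hK (hKs.trans openSimplex_subset_massDomain)
  have huc : UniformContinuous (fderiv ℝ Y) :=
    (hYs.fderiv ℝ).uniformContinuous_of_continuous (hY.continuous_fderiv one_ne_zero)
  have hn : (0 : ℝ) < Fintype.card V := by positivity
  set κ := η / (2 * Fintype.card V) with hκ
  have hκ0 : 0 < κ := by positivity
  obtain ⟨δ₁, hδ₁, H⟩ := Metric.uniformContinuous_iff.1 huc κ hκ0
  -- first-order expansion of `f` at points of `K`, with a uniform remainder
  have hexp : ∀ a ∈ K, ∀ x ∈ openSimplex V, ‖x - a‖ < min δ₀ δ₁ →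
      ‖f x - f a - fderiv ℝ (fun x => f (massProj x)) a (x - a)‖ ≤ κ * ‖x - a‖ := by
    intro a ha x hx hxa
    have hmem : ∀ z, ‖z - a‖ < δ₀ → z ∈ Metric.thickening δ₀ K := fun z hz =>
      Metric.mem_thickening_iff.2 ⟨a, ha, by rwa [dist_eq_norm]⟩
    have hev : Y =ᶠ[𝓝 a] fun x => f (massProj x) := by
      filter_upwards [Metric.isOpen_thickening.mem_nhds (hmem a (by simpa using hδ₀))] with z hz
        using hYf hz
    rw [← hev.fderiv_eq]
    have e : f x - f a = Y x - Y a := by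
      rw [hYf (hmem x (hxa.trans_le (min_le_left _ _))), hYf (hmem a (by simpa using hδ₀))]
      simp only [massProj_of_sum_eq_one hx.1.2, massProj_of_sum_eq_one (hKs ha).1.2]
    rw [e]
    refine (convex_ball a (min δ₀ δ₁)).norm_image_sub_le_of_norm_fderiv_le'
      (fun z _ => hY.differentiable one_ne_zero z) (fun z hz => ?_)
      (Metric.mem_ball_self (lt_min hδ₀ hδ₁)) (by rwa [mem_ball_iff_norm])
    rw [← dist_eq_norm]
    exact (H (lt_of_lt_of_le (Metric.mem_ball.1 hz) (min_le_right _ _))).le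
  refine ⟨min δ₀ δ₁, lt_min hδ₀ hδ₁, fun a ha x hx y hy hxa hya => ?_⟩
  have hsum : ∀ z ∈ openSimplex V, ∑ i, (z - a) i = 0 := fun z hz => by
    simp [hz.1.2, (hKs ha).1.2]
  have hsymm := hf.fderiv_symm hf1 (openSimplex_subset_massDomain (hKs ha))
    (hsum x hx) (hsum y hy)
  set A := fderiv ℝ (fun x => f (massProj x)) a with hA
  have e : ∑ i, (f x i - f a i) * (y i - a i) - ∑ i, (f y i - f a i) * (x i - a i)
      = ∑ i, (f x - f a - A (x - a)) i * (y - a) i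
        - ∑ i, (f y - f a - A (y - a)) i * (x - a) i := by
    simp only [Pi.sub_apply, sub_mul (_ - _) (A _ _), Finset.sum_sub_distrib]
    simp only [Pi.sub_apply] at hsymm
    rw [hsymm]; ring
  rw [e]
  have h1 := abs_sum_mul_le (f x - f a - A (x - a)) (y - a)
  have h2 := abs_sum_mul_le (f y - f a - A (y - a)) (x - a)
  have h3 := mul_le_mul_of_nonneg_right (hexp a ha x hx hxa) (norm_nonneg (y - a))
  have h4 := mul_le_mul_of_nonneg_right (hexp a ha y hy hya) (norm_nonneg (x - a))
  have h5 := mul_le_mul_of_nonneg_left h3 hn.le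
  have h6 := mul_le_mul_of_nonneg_left h4 hn.le
  have e7 : Fintype.card V * (κ * ‖x - a‖ * ‖y - a‖) + Fintype.card V * (κ * ‖y - a‖ * ‖x - a‖)
      = η * (‖x - a‖ * ‖y - a‖) := by
    rw [hκ]; field_simp; ring
  exact (abs_sub _ _).trans (by linarith)

end Extension

/-! ### Pairings of increments of trajectories -/

section Pairings

variable {V : Type*} [Fintype V] (Γ : SimpleGraph V) [DecidableRel Γ.Adj] {w : V → V → ℝ}

/-- The rate of change of the pairing `⟨s - S, r - ρ⟩` of two trajectories: it is nonpositive, and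
controls the difference of the potential gradients. -/
theorem pairing_rate_le (hw : ∀ i j, w i j = w j i) {f : (V → ℝ) → V → ℝ} {r s ρ S : V → ℝ}
    (hmono : 0 ≤ ∑ i, (f r i - f ρ i) * (r i - ρ i)) :
    ∑ i, (((valueRate Γ w s i - f r i) - (valueRate Γ w S i - f ρ i)) * (r i - ρ i)
        + (s i - S i) * (densityRate Γ w r s i - densityRate Γ w ρ S i))
      ≤ -((1 / 4) * ∑ i, ∑ j ∈ Γ.neighborFinset i,
          w i j * ((s i - S i) - (s j - S j)) ^ 2 * (theta r i j + theta ρ i j)) := by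
  have e : ∑ i, (((valueRate Γ w s i - f r i) - (valueRate Γ w S i - f ρ i)) * (r i - ρ i)
        + (s i - S i) * (densityRate Γ w r s i - densityRate Γ w ρ S i))
      = ∑ i, (r i - ρ i) * valueRate Γ w s i - ∑ i, (r i - ρ i) * valueRate Γ w S i
        + ∑ i, (s i - S i) * densityRate Γ w r s i - ∑ i, (s i - S i) * densityRate Γ w ρ S i
        - ∑ i, (f r i - f ρ i) * (r i - ρ i) := by
    simp only [← Finset.sum_sub_distrib, ← Finset.sum_add_distrib]
    exact Finset.sum_congr rfl fun i _ => by ring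
  have e2 : ∑ i, (r i - ρ i) * valueRate Γ w s i - ∑ i, (r i - ρ i) * valueRate Γ w S i
        + ∑ i, (s i - S i) * densityRate Γ w r s i - ∑ i, (s i - S i) * densityRate Γ w ρ S i
      = -((1 / 4) * ∑ i, ∑ j ∈ Γ.neighborFinset i,
          w i j * ((s i - S i) - (s j - S j)) ^ 2 * (theta r i j + theta ρ i j)) := by
    simp only [sum_mul_valueRate Γ hw, sum_mul_densityRate Γ hw, theta_sub, Finset.mul_sum,
      ← Finset.sum_sub_distrib, ← Finset.sum_add_distrib, ← Finset.sum_neg_distrib]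
    exact Finset.sum_congr rfl fun i _ => Finset.sum_congr rfl fun j _ => by ring
  rw [e, e2]; linarith

/-- The rate of change of the symplectic form of the increments of two perturbations `(r, s)` and
`(r', s')` of a trajectory `(ρ, S)`: the second-order terms on the edges cancel, since the coupled
system is Hamiltonian. -/
theorem symplectic_rate_eq (hw : ∀ i j, w i j = w j i) (f : (V → ℝ) → V → ℝ)
    (r s r' s' ρ S : V → ℝ) :
    ∑ i, (((densityRate Γ w r s i - densityRate Γ w ρ S i) * (s' i - S i)
        + (r i - ρ i) * ((valueRate Γ w s' i - f r' i) - (valueRate Γ w S i - f ρ i)))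
        - (((valueRate Γ w s i - f r i) - (valueRate Γ w S i - f ρ i)) * (r' i - ρ i)
        + (s i - S i) * (densityRate Γ w r' s' i - densityRate Γ w ρ S i)))
      = ∑ i, ∑ j ∈ Γ.neighborFinset i, w i j *
          ((1 / 4) * ((s' i - S i) - (s' j - S j)) *
              (((s' i - S i) - (s' j - S j)) - 2 * ((s i - S i) - (s j - S j)))
              * theta (fun k => r k - ρ k) i j
            - (1 / 4) * ((s i - S i) - (s j - S j)) *
              (((s i - S i) - (s j - S j)) - 2 * ((s' i - S i) - (s' j - S j)))
              * theta (fun k => r' k - ρ k) i j)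
        + (∑ i, (f r i - f ρ i) * (r' i - ρ i) - ∑ i, (f r' i - f ρ i) * (r i - ρ i)) := by
  have e : ∑ i, (((densityRate Γ w r s i - densityRate Γ w ρ S i) * (s' i - S i)
        + (r i - ρ i) * ((valueRate Γ w s' i - f r' i) - (valueRate Γ w S i - f ρ i)))
        - (((valueRate Γ w s i - f r i) - (valueRate Γ w S i - f ρ i)) * (r' i - ρ i)
        + (s i - S i) * (densityRate Γ w r' s' i - densityRate Γ w ρ S i)))
      = (∑ i, (s' i - S i) * densityRate Γ w r s i - ∑ i, (s' i - S i) * densityRate Γ w ρ S i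
        + ∑ i, (r i - ρ i) * valueRate Γ w s' i - ∑ i, (r i - ρ i) * valueRate Γ w S i
        - ∑ i, (r' i - ρ i) * valueRate Γ w s i + ∑ i, (r' i - ρ i) * valueRate Γ w S i
        - ∑ i, (s i - S i) * densityRate Γ w r' s' i
        + ∑ i, (s i - S i) * densityRate Γ w ρ S i)
        + (∑ i, (f r i - f ρ i) * (r' i - ρ i) - ∑ i, (f r' i - f ρ i) * (r i - ρ i)) := by
    simp only [← Finset.sum_sub_distrib, ← Finset.sum_add_distrib]
    exact Finset.sum_congr rfl fun i _ => by ring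
  rw [e]
  congr 1
  simp only [sum_mul_valueRate Γ hw, sum_mul_densityRate Γ hw, theta_sub, Finset.mul_sum,
    ← Finset.sum_sub_distrib, ← Finset.sum_add_distrib, ← Finset.sum_neg_distrib]
  exact Finset.sum_congr rfl fun i _ => Finset.sum_congr rfl fun j _ => by ring

theorem abs_theta_le {V : Type*} [Fintype V] (x : V → ℝ) (i j : V) : |theta x i j| ≤ ‖x‖ := by
  have h1 := norm_le_pi_norm x i
  have h2 := norm_le_pi_norm x j
  rw [Real.norm_eq_abs] at h1 h2
  rw [theta, abs_div, abs_two, div_le_iff₀ two_pos]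
  exact (abs_add_le _ _).trans (by linarith)

theorem abs_symplectic_rate_le (hw : ∀ i j, w i j = w j i) (f : (V → ℝ) → V → ℝ)
    {r s r' s' ρ S : V → ℝ} {b κ : ℝ} (hr : ‖r - ρ‖ ≤ b) (hs : ‖s - S‖ ≤ b)
    (hr' : ‖r' - ρ‖ ≤ b) (hs' : ‖s' - S‖ ≤ b)
    (hκ : |∑ i, (f r i - f ρ i) * (r' i - ρ i) - ∑ i, (f r' i - f ρ i) * (r i - ρ i)| ≤ κ) :
    |∑ i, (((densityRate Γ w r s i - densityRate Γ w ρ S i) * (s' i - S i)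
        + (r i - ρ i) * ((valueRate Γ w s' i - f r' i) - (valueRate Γ w S i - f ρ i)))
        - (((valueRate Γ w s i - f r i) - (valueRate Γ w S i - f ρ i)) * (r' i - ρ i)
        + (s i - S i) * (densityRate Γ w r' s' i - densityRate Γ w ρ S i)))|
      ≤ (6 * ∑ i, ∑ j ∈ Γ.neighborFinset i, |w i j|) * b ^ 3 + κ := by
  have hb : 0 ≤ b := (norm_nonneg _).trans hr
  have hdiff : ∀ {x : V → ℝ}, ‖x‖ ≤ b → ∀ i j, |x i - x j| ≤ 2 * b := fun {x} hx i j => by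
    have h1 := norm_le_pi_norm x i
    have h2 := norm_le_pi_norm x j
    rw [Real.norm_eq_abs] at h1 h2
    exact (abs_sub _ _).trans (by linarith)
  have hcub : ∀ {A B c : ℝ}, |A| ≤ 2 * b → |B| ≤ 2 * b → |c| ≤ b →
      |(1 / 4) * A * (A - 2 * B) * c| ≤ 3 * b ^ 3 := by
    intro A B c hA hB hc
    have h1 : |A - 2 * B| ≤ 6 * b := by
      refine (abs_sub _ _).trans ?_
      rw [abs_mul, abs_two]; linarith
    rw [abs_mul, abs_mul, abs_mul, abs_of_pos (by norm_num : (0 : ℝ) < 1 / 4)]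
    calc 1 / 4 * |A| * |A - 2 * B| * |c| ≤ 1 / 4 * (2 * b) * (6 * b) * b := by gcongr
      _ = 3 * b ^ 3 := by ring
  rw [symplectic_rate_eq Γ hw]
  refine (abs_add_le _ _).trans (add_le_add ?_ hκ)
  rw [Finset.mul_sum, Finset.sum_mul]
  refine (Finset.abs_sum_le_sum_abs _ _).trans (Finset.sum_le_sum fun i _ => ?_)
  rw [Finset.mul_sum, Finset.sum_mul]
  refine (Finset.abs_sum_le_sum_abs _ _).trans (Finset.sum_le_sum fun j _ => ?_)
  have h1 := hcub (hdiff hs' i j) (hdiff hs i j) ((abs_theta_le (r - ρ) i j).trans hr)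
  have h2 := hcub (hdiff hs i j) (hdiff hs' i j) ((abs_theta_le (r' - ρ) i j).trans hr')
  rw [abs_mul]
  have h3 := (abs_sub _ _).trans (add_le_add h1 h2)
  calc _ ≤ |w i j| * (3 * b ^ 3 + 3 * b ^ 3) := mul_le_mul_of_nonneg_left h3 (abs_nonneg _)
    _ = _ := by ring

end Pairings

/-! ### The coupled system as a vector field -/

section Perturbation

variable {V : Type*} [Fintype V] {Γ : SimpleGraph V} [DecidableRel Γ.Adj]
  {w : V → V → ℝ} {f : (V → ℝ) → V → ℝ} {T : ℝ} {ρ S : ℝ → V → ℝ}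

/-- The coupled system as an autonomous vector field. The first variation is precomposed with
`massProj`, which makes it `C¹` on an open set and does not change it on densities. -/
def coupledField (Γ : SimpleGraph V) [DecidableRel Γ.Adj] (w : V → V → ℝ)
    (f : (V → ℝ) → V → ℝ) (y : (V → ℝ) × (V → ℝ)) : (V → ℝ) × (V → ℝ) :=
  (fun i => densityRate Γ w y.1 y.2 i, fun i => valueRate Γ w y.2 i - f (massProj y.1) i)

theorem contDiffOn_coupledField [Nonempty V] (hf1 : ContDiffOn ℝ 1 f (openSimplex V)) :
    ContDiffOn ℝ 1 (coupledField Γ w f) (massDomain V ×ˢ univ) := by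
  refine ContDiffOn.prodMk (contDiffOn_pi.2 fun i => ?_) (contDiffOn_pi.2 fun i => ?_)
  · refine ContDiff.contDiffOn ?_
    simp only [densityRate, theta]
    fun_prop
  · refine ContDiffOn.sub (ContDiff.contDiffOn ?_) ?_
    · simp only [valueRate]
      fun_prop
    · exact contDiffOn_pi.1 ((contDiffOn_comp_massProj hf1).comp contDiffOn_fst
        fun y hy => hy.1) i

theorem SolvesCoupledSystem.hasDerivWithinAt (h : SolvesCoupledSystem Γ w f T ρ S) :
    ∀ t ∈ Icc 0 T, HasDerivWithinAt (fun t => (ρ t, S t)) (coupledField Γ w f (ρ t, S t))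
      (Icc 0 T) t := fun t ht => by
  refine HasDerivWithinAt.prodMk (hasDerivWithinAt_pi.2 fun i => h.continuity t ht i)
    (hasDerivWithinAt_pi.2 fun i => ?_)
  simp only [massProj_of_sum_eq_one (h.mem_openSimplex t ht).1.2]
  exact h.hamiltonJacobi t ht i

theorem SolvesCoupledSystem.mem_domain (h : SolvesCoupledSystem Γ w f T ρ S) :
    ∀ t ∈ Icc 0 T, (ρ t, S t) ∈ massDomain V ×ˢ (univ : Set (V → ℝ)) := fun t ht =>
  ⟨openSimplex_subset_massDomain (h.mem_openSimplex t ht), mem_univ _⟩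

theorem solvesCoupledSystem_of_hasDerivWithinAt [Nonempty V] (hw : ∀ i j, w i j = w j i)
    {z : ℝ → (V → ℝ) × (V → ℝ)} (hmem : ∀ t ∈ Icc 0 T, z t ∈ massDomain V ×ˢ univ)
    (hz : ∀ t ∈ Icc 0 T, HasDerivWithinAt z (coupledField Γ w f (z t)) (Icc 0 T) t)
    {t₀ : ℝ} (ht₀ : t₀ ∈ Icc 0 T) (hmass : ∑ i, (z t₀).1 i = 1) :
    SolvesCoupledSystem Γ w f T (fun t => (z t).1) (fun t => (z t).2) := by
  have h1 : ∀ t ∈ Icc 0 T, ∀ i, HasDerivWithinAt (fun s => (z s).1 i)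
      (densityRate Γ w (z t).1 (z t).2 i) (Icc 0 T) t := fun t ht i =>
    hasDerivWithinAt_pi.1 ((ContinuousLinearMap.fst ℝ (V → ℝ) (V → ℝ)).hasFDerivAt.comp_hasDerivWithinAt
      t (hz t ht)) i
  have h2 : ∀ t ∈ Icc 0 T, ∀ i, HasDerivWithinAt (fun s => (z s).2 i)
      (valueRate Γ w (z t).2 i - f (massProj (z t).1) i) (Icc 0 T) t := fun t ht i =>
    hasDerivWithinAt_pi.1 ((ContinuousLinearMap.snd ℝ (V → ℝ) (V → ℝ)).hasFDerivAt.comp_hasDerivWithinAt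
      t (hz t ht)) i
  have hsum : ∀ t ∈ Icc 0 T, HasDerivWithinAt (fun s => ∑ i, (z s).1 i) 0 (Icc 0 T) t := by
    intro t ht
    have := HasDerivWithinAt.fun_sum (u := Finset.univ) fun i _ => h1 t ht i
    rwa [sum_densityRate Γ hw] at this
  have hconst := eq_add_integral_of_hasDerivWithinAt (ψ := fun _ => 0) continuousOn_const hsum
  simp only [intervalIntegral.integral_zero, add_zero] at hconst
  have hone : ∀ t ∈ Icc 0 T, massProj (z t).1 = (z t).1 := fun t ht =>
    massProj_of_sum_eq_one (by rw [hconst t ht, ← hconst t₀ ht₀, hmass])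
  refine ⟨fun t ht => ?_, h1, fun t ht i => ?_⟩
  · have := massProj_mem (hmem t ht).1
    rwa [hone t ht] at this
  · have := h2 t ht i
    rwa [hone t ht] at this

theorem SolvesCoupledSystem.eqOn [Nonempty V] (hf1 : ContDiffOn ℝ 1 f (openSimplex V))
    {ρ' S' : ℝ → V → ℝ} (h : SolvesCoupledSystem Γ w f T ρ S)
    (h' : SolvesCoupledSystem Γ w f T ρ' S') (hρ : ρ' 0 = ρ 0) (hS : S' 0 = S 0) :
    EqOn ρ' ρ (Icc 0 T) ∧ EqOn S' S (Icc 0 T) := by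
  have := eqOn_of_hasDerivWithinAt (isOpen_massDomain.prod isOpen_univ)
    (contDiffOn_coupledField hf1) h.mem_domain h'.mem_domain h.hasDerivWithinAt
    h'.hasDerivWithinAt (by rw [hρ, hS])
  exact ⟨fun t ht => congrArg Prod.fst (this ht), fun t ht => congrArg Prod.snd (this ht)⟩

theorem SolvesCoupledSystem.exists_nearby [Nonempty V] (hw : ∀ i j, w i j = w j i)
    (hT : 0 ≤ T) (hf1 : ContDiffOn ℝ 1 f (openSimplex V))
    (h : SolvesCoupledSystem Γ w f T ρ S) :
    ∃ δ > 0, ∃ C > 0, ∀ s₀, ‖s₀ - S 0‖ ≤ δ → ∃ r s, SolvesCoupledSystem Γ w f T r s ∧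
      r 0 = ρ 0 ∧ s 0 = s₀ ∧ ∀ t ∈ Icc 0 T,
        ‖r t - ρ t‖ ≤ C * ‖s₀ - S 0‖ ∧ ‖s t - S t‖ ≤ C * ‖s₀ - S 0‖ := by
  have h0 : (0 : ℝ) ∈ Icc 0 T := ⟨le_rfl, hT⟩
  obtain ⟨δ, hδ, C, hC, H⟩ := exists_nearby_solution (isOpen_massDomain.prod isOpen_univ)
    (contDiffOn_coupledField hf1) hT h.mem_domain h.hasDerivWithinAt
  refine ⟨δ, hδ, C, hC, fun s₀ hs₀ => ?_⟩
  have en : ‖((ρ 0, s₀) : (V → ℝ) × (V → ℝ)) - (ρ 0, S 0)‖ = ‖s₀ - S 0‖ := by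
    simp [Prod.norm_def]
  obtain ⟨z, hz0, hz⟩ := H (ρ 0, s₀) (by rwa [en])
  rw [en] at hz
  refine ⟨fun t => (z t).1, fun t => (z t).2, ?_, by simp [hz0], by simp [hz0], fun t ht => ?_⟩
  · refine solvesCoupledSystem_of_hasDerivWithinAt hw (fun t ht => (hz t ht).1)
      (fun t ht => (hz t ht).2.1) h0 ?_
    rw [hz0]; exact (h.mem_openSimplex 0 h0).1.2
  · have := (hz t ht).2.2.1
    exact ⟨(norm_fst_le _).trans this, (norm_snd_le _).trans this⟩

theorem SolvesCoupledSystem.exists_nearby_backward [Nonempty V] (hw : ∀ i j, w i j = w j i)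
    (hT : 0 ≤ T) (hf1 : ContDiffOn ℝ 1 f (openSimplex V))
    (h : SolvesCoupledSystem Γ w f T ρ S) :
    ∃ δ > 0, ∃ C > 0, ∀ s₁, ‖s₁ - S T‖ ≤ δ → ∃ r s, SolvesCoupledSystem Γ w f T r s ∧
      r T = ρ T ∧ s T = s₁ ∧ ∀ t ∈ Icc 0 T,
        ‖r t - ρ t‖ ≤ C * ‖s₁ - S T‖ ∧ ‖s t - S t‖ ≤ C * ‖s₁ - S T‖ ∧
        ∀ i, |(valueRate Γ w (s t) i - f (r t) i) - (valueRate Γ w (S t) i - f (ρ t) i)|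
          ≤ C * ‖s₁ - S T‖ := by
  have h0 : T ∈ Icc 0 T := ⟨hT, le_rfl⟩
  obtain ⟨δ, hδ, C, hC, H⟩ := exists_nearby_solution_backward
    (isOpen_massDomain.prod isOpen_univ)
    (contDiffOn_coupledField hf1) hT h.mem_domain h.hasDerivWithinAt
  refine ⟨δ, hδ, C, hC, fun s₁ hs₁ => ?_⟩
  have en : ‖((ρ T, s₁) : (V → ℝ) × (V → ℝ)) - (ρ T, S T)‖ = ‖s₁ - S T‖ := by
    simp [Prod.norm_def]
  obtain ⟨z, hz0, hz⟩ := H (ρ T, s₁) (by rwa [en])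
  rw [en] at hz
  have hsol : SolvesCoupledSystem Γ w f T (fun t => (z t).1) (fun t => (z t).2) := by
    refine solvesCoupledSystem_of_hasDerivWithinAt hw (fun t ht => (hz t ht).1)
      (fun t ht => (hz t ht).2.1) h0 ?_
    rw [hz0]; exact (h.mem_openSimplex T h0).1.2
  refine ⟨fun t => (z t).1, fun t => (z t).2, hsol, by simp [hz0], by simp [hz0],
    fun t ht => ⟨?_, ?_, fun i => ?_⟩⟩
  · exact (norm_fst_le _).trans (hz t ht).2.2.1
  · exact (norm_snd_le _).trans (hz t ht).2.2.1
  · have h2 := (norm_snd_le _).trans (hz t ht).2.2.2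
    have h3 := (norm_le_pi_norm _ i).trans h2
    have e1 := massProj_of_sum_eq_one (hsol.mem_openSimplex t ht).1.2
    have e2 := massProj_of_sum_eq_one (h.mem_openSimplex t ht).1.2
    simpa [coupledField, e1, e2] using h3

end Perturbation

/-! ### The transversality condition -/

section TerminalCondition

variable {V : Type*} [Fintype V] {Γ : SimpleGraph V} [DecidableRel Γ.Adj]
  {w : V → V → ℝ} {f : (V → ℝ) → V → ℝ} {T : ℝ} {ρ S : ℝ → V → ℝ}

theorem IsFirstVariation.exists_le_add {F : (V → ℝ) → ℝ} (hf : IsFirstVariation F f) {x : V → ℝ}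
    (hx : x ∈ openSimplex V) {κ : ℝ} (hκ : 0 < κ) :
    ∃ δ > 0, ∀ y ∈ stdSimplex ℝ V, ‖y - x‖ < δ →
      F y ≤ F x + ∑ i, f x i * (y i - x i) + κ * ‖y - x‖ := by
  have h := (hf x hx).isLittleO.def hκ
  obtain ⟨δ, hδ, H⟩ := Metric.mem_nhdsWithin_iff.1 h
  refine ⟨δ, hδ, fun y hy hyx => ?_⟩
  have := H ⟨by rwa [mem_ball_iff_norm], hy⟩
  rw [mem_ofPred_eq, Real.norm_eq_abs] at this
  have h2 := (abs_le.1 this).2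
  simp only [sum_apply, smul_apply, ContinuousLinearMap.proj_apply,
    Pi.sub_apply, smul_eq_mul] at h2
  linarith

theorem eventually_mul_lt (A : ℝ) {b : ℝ} (hb : 0 < b) : ∀ᶠ ε in 𝓝[>] (0 : ℝ), A * ε < b := by
  have : Tendsto (fun ε : ℝ => A * ε) (𝓝[>] 0) (𝓝 (A * 0)) :=
    (tendsto_id.const_mul A).mono_left nhdsWithin_le_nhds
  rw [mul_zero] at this
  exact this.eventually_lt_const hb

theorem norm_sq_le_sum_sq (a : V → ℝ) : ‖a‖ ^ 2 ≤ ∑ i, a i * a i := by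
  have h0 : 0 ≤ ∑ i, a i * a i := Finset.sum_nonneg fun i _ => mul_self_nonneg _
  have : ‖a‖ ≤ Real.sqrt (∑ i, a i * a i) := by
    rw [pi_norm_le_iff_of_nonneg (Real.sqrt_nonneg _)]
    intro i
    refine Real.abs_le_sqrt ?_
    rw [sq]
    exact Finset.single_le_sum (f := fun i => a i * a i) (fun i _ => mul_self_nonneg _)
      (Finset.mem_univ i)
  calc ‖a‖ ^ 2 ≤ Real.sqrt (∑ i, a i * a i) ^ 2 := by gcongr
    _ = _ := Real.sq_sqrt h0

theorem SolvesCoupledSystem.hasDerivWithinAt_pairing {r s : ℝ → V → ℝ}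
    (h : SolvesCoupledSystem Γ w f T ρ S) (h' : SolvesCoupledSystem Γ w f T r s) :
    ∀ t ∈ Icc 0 T, HasDerivWithinAt (fun t => ∑ i, (s t i - S t i) * (r t i - ρ t i))
      (∑ i, (((valueRate Γ w (s t) i - f (r t) i) - (valueRate Γ w (S t) i - f (ρ t) i))
        * (r t i - ρ t i)
        + (s t i - S t i) * (densityRate Γ w (r t) (s t) i - densityRate Γ w (ρ t) (S t) i)))
      (Icc 0 T) t := fun t ht =>
  HasDerivWithinAt.fun_sum fun i _ =>
    ((h'.hamiltonJacobi t ht i).sub (h.hamiltonJacobi t ht i)).mul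
      ((h'.continuity t ht i).sub (h.continuity t ht i))

/-- Shifting the terminal value of `S` by `ε p`, with `p` not constant along an edge, while keeping
the terminal density, moves the initial density by an amount of exact order `ε`. -/
theorem SolvesCoupledSystem.exists_backward_gap [Nonempty V] (hw : ∀ i j, w i j = w j i)
    (hw_pos : ∀ i j, Γ.Adj i j → 0 < w i j) (hT : 0 < T) {F : (V → ℝ) → ℝ}
    (hF : ConvexOn ℝ (stdSimplex ℝ V) F) (hf : IsFirstVariation F f)
    (hf1 : ContDiffOn ℝ 1 f (openSimplex V)) (h : SolvesCoupledSystem Γ w f T ρ S)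
    {p : V → ℝ} {i₀ j₀ : V} (hadj : Γ.Adj i₀ j₀) (hp : p i₀ ≠ p j₀) :
    ∃ δ > 0, ∃ C > 0, ∃ c > 0, ∀ ε > 0, ε ≤ δ → ∃ r s, SolvesCoupledSystem Γ w f T r s ∧
      r T = ρ T ∧ s T = S T + ε • p ∧
      (∀ t ∈ Icc 0 T, ‖r t - ρ t‖ ≤ C * ε ∧ ‖s t - S t‖ ≤ C * ε) ∧ c * ε ≤ ‖r 0 - ρ 0‖ := by
  have h0m : (0 : ℝ) ∈ Icc 0 T := ⟨le_rfl, hT.le⟩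
  have hTm : T ∈ Icc 0 T := ⟨hT.le, le_rfl⟩
  obtain ⟨δ₁, hδ₁, C₁, hC₁, H⟩ := h.exists_nearby_backward hw hT.le hf1
  have hP : 0 < ‖p‖ := norm_pos_iff.2 fun h => hp (by simp [h])
  obtain ⟨t₀, ht₀, hmin⟩ := isCompact_Icc.exists_isMinOn ⟨0, h0m⟩
    (continuousOn_pi.1 h.continuousOn_density i₀)
  set m := ρ t₀ i₀ with hm
  have hm0 : 0 < m := (h.mem_openSimplex t₀ ht₀).2 i₀
  set C := C₁ * ‖p‖ with hC
  have hC0 : 0 < C := by positivity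
  set q := |p i₀ - p j₀| with hq
  have hq0 : 0 < q := abs_pos.2 (sub_ne_zero.2 hp)
  set τ := min T (q / (4 * C)) with hτ
  have hτ0 : 0 < τ := lt_min hT (by positivity)
  have hτC : C * τ ≤ q / 4 := by
    calc C * τ ≤ C * (q / (4 * C)) := mul_le_mul_of_nonneg_left (min_le_right _ _) hC0.le
      _ = q / 4 := by field_simp
  have hwp := hw_pos i₀ j₀ hadj
  set k := w i₀ j₀ * m / 8 with hk
  have hk0 : 0 < k := by positivity
  have hn : (0 : ℝ) < Fintype.card V := by positivity
  refine ⟨δ₁ / ‖p‖, by positivity, C, hC0, k * τ * q ^ 2 / (4 * (Fintype.card V * C)),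
    by positivity, fun ε hε hεδ => ?_⟩
  have hshift : ‖S T + ε • p - S T‖ = ‖p‖ * ε := by
    rw [add_sub_cancel_left, norm_smul, Real.norm_eq_abs, abs_of_pos hε, mul_comm]
  obtain ⟨r, s, hrs, hrT, hsT, hB⟩ := H (S T + ε • p) (by
    rw [hshift]
    rw [le_div_iff₀ hP] at hεδ
    linarith)
  rw [hshift, ← mul_assoc, ← hC] at hB
  refine ⟨r, s, hrs, hrT, hsT, fun t ht => ⟨(hB t ht).1, (hB t ht).2.1⟩, ?_⟩
  -- the pairing `φ` vanishes at `T`, is nonincreasing, and decreases at a definite rate near `T`,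
  -- where the gradient of `s - S` is still close to that of `ε p`
  set φ : ℝ → ℝ := fun t => ∑ i, (s t i - S t i) * (r t i - ρ t i) with hφ
  set D : ℝ → ℝ := fun t => (s t i₀ - S t i₀) - (s t j₀ - S t j₀) with hD
  have hφ' := h.hasDerivWithinAt_pairing hrs
  have hrate : ∀ t ∈ Icc 0 T,
      ∑ i, (((valueRate Γ w (s t) i - f (r t) i) - (valueRate Γ w (S t) i - f (ρ t) i))
        * (r t i - ρ t i)
        + (s t i - S t i) * (densityRate Γ w (r t) (s t) i - densityRate Γ w (ρ t) (S t) i))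
      ≤ -(k * D t ^ 2) := by
    intro t ht
    have hr := hrs.mem_openSimplex t ht
    have hρ := h.mem_openSimplex t ht
    refine (pairing_rate_le Γ hw (hf.monotone hF hρ hr)).trans ?_
    have hnn : ∀ i j, j ∈ Γ.neighborFinset i → 0 ≤ w i j
        * ((s t i - S t i) - (s t j - S t j)) ^ 2 * (theta (r t) i j + theta (ρ t) i j) := by
      intro i j hj
      have hij := hw_pos i j (by simpa using hj)
      have h1 := hr.2 i
      have h2 := hr.2 j
      have h3 := hρ.2 i
      have h4 := hρ.2 j
      simp only [theta]
      positivity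
    have h1 := Finset.single_le_sum (f := fun i => ∑ j ∈ Γ.neighborFinset i, w i j
        * ((s t i - S t i) - (s t j - S t j)) ^ 2 * (theta (r t) i j + theta (ρ t) i j))
      (fun i _ => Finset.sum_nonneg (hnn i)) (Finset.mem_univ i₀)
    have h2 := Finset.single_le_sum (f := fun j => w i₀ j
        * ((s t i₀ - S t i₀) - (s t j - S t j)) ^ 2 * (theta (r t) i₀ j + theta (ρ t) i₀ j))
      (hnn i₀) (show j₀ ∈ Γ.neighborFinset i₀ by simpa using hadj)
    have h3 : m / 2 ≤ theta (r t) i₀ j₀ + theta (ρ t) i₀ j₀ := by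
      have h1 := hr.2 i₀
      have h2 := hr.2 j₀
      have h3 : m ≤ ρ t i₀ := hmin ht
      have h4 := hρ.2 j₀
      simp only [theta]
      linarith
    have h4 := mul_le_mul_of_nonneg_left h3 (mul_nonneg hwp.le (sq_nonneg (D t)))
    simp only [hD] at h4 ⊢
    have e : w i₀ j₀ * ((s t i₀ - S t i₀) - (s t j₀ - S t j₀)) ^ 2 * (m / 2)
        = 4 * (k * ((s t i₀ - S t i₀) - (s t j₀ - S t j₀)) ^ 2) := by
      rw [hk]; ring
    linarith
  have hDT : D T = ε * (p i₀ - p j₀) := by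
    simp only [hD, hsT, Pi.add_apply, Pi.smul_apply, smul_eq_mul]; ring
  have hDd : ∀ t ∈ Icc 0 T, HasDerivWithinAt D
      (((valueRate Γ w (s t) i₀ - f (r t) i₀) - (valueRate Γ w (S t) i₀ - f (ρ t) i₀))
        - ((valueRate Γ w (s t) j₀ - f (r t) j₀) - (valueRate Γ w (S t) j₀ - f (ρ t) j₀)))
      (Icc 0 T) t := fun t ht =>
    ((hrs.hamiltonJacobi t ht i₀).sub (h.hamiltonJacobi t ht i₀)).sub
      ((hrs.hamiltonJacobi t ht j₀).sub (h.hamiltonJacobi t ht j₀))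
  have hDlow : ∀ t ∈ Icc (T - τ) T, (ε * q / 2) ^ 2 ≤ D t ^ 2 := by
    intro t ht
    have htm : t ∈ Icc 0 T := ⟨by linarith [ht.1, min_le_left T (q / (4 * C))], ht.2⟩
    have hsub : Icc t T ⊆ Icc 0 T := Icc_subset_Icc htm.1 le_rfl
    have hbd : ∀ u ∈ Icc t T,
        |((valueRate Γ w (s u) i₀ - f (r u) i₀) - (valueRate Γ w (S u) i₀ - f (ρ u) i₀))
        - ((valueRate Γ w (s u) j₀ - f (r u) j₀) - (valueRate Γ w (S u) j₀ - f (ρ u) j₀))|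
        ≤ 2 * (C * ε) := fun u hu => by
      have h1 := (hB u (hsub hu)).2.2 i₀
      have h2 := (hB u (hsub hu)).2.2 j₀
      exact (abs_sub _ _).trans (by linarith)
    have h1 := sub_le_of_hasDerivWithinAt_le ht.2 (fun u hu => (hDd u (hsub hu)).mono hsub)
      (fun u hu => (abs_le.1 (hbd u hu)).2)
    have h2 := sub_le_of_hasDerivWithinAt_le ht.2 (fun u hu => ((hDd u (hsub hu)).mono hsub).neg)
      (fun u hu => neg_le.1 (abs_le.1 (hbd u hu)).1)
    have h3 : 2 * (C * ε) * (T - t) ≤ ε * q / 2 := by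
      have : C * ε * (T - t) ≤ C * ε * τ :=
        mul_le_mul_of_nonneg_left (by linarith [ht.1]) (by positivity)
      have h4 := mul_le_mul_of_nonneg_left hτC hε.le
      linarith
    have h4 : |D T| = ε * q := by rw [hDT, abs_mul, abs_of_pos hε]
    have h5 : |D T| - |D t| ≤ |D T - D t| := abs_sub_abs_le_abs_sub _ _
    have h6 : |D T - D t| ≤ ε * q / 2 := abs_le.2 ⟨by
      simp only [Pi.neg_apply] at h2; linarith, by linarith⟩
    rw [← sq_abs (D t)]
    gcongr
    linarith
  have hTτ : 0 ≤ T - τ := sub_nonneg.2 (min_le_left _ _)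
  have hs1 : Icc (T - τ) T ⊆ Icc 0 T := Icc_subset_Icc hTτ le_rfl
  have hs2 : Icc 0 (T - τ) ⊆ Icc 0 T := Icc_subset_Icc le_rfl (by linarith)
  have hdec1 := sub_le_of_hasDerivWithinAt_le (C := -(k * (ε * q / 2) ^ 2))
    (by linarith : T - τ ≤ T) (fun u hu => (hφ' u (hs1 hu)).mono hs1) (fun u hu =>
      (hrate u (hs1 hu)).trans (neg_le_neg (mul_le_mul_of_nonneg_left (hDlow u hu) hk0.le)))
  have hdec2 := sub_le_of_hasDerivWithinAt_le (C := 0)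
    hTτ (fun u hu => (hφ' u (hs2 hu)).mono hs2) (fun u hu =>
      (hrate u (hs2 hu)).trans (neg_nonpos.2 (by positivity)))
  have hφT : φ T = 0 := by simp [hφ, hrT]
  have hφ0 : φ 0 ≤ Fintype.card V * (C * ε * ‖r 0 - ρ 0‖) := by
    refine (le_abs_self _).trans ((abs_sum_mul_le (s 0 - S 0) (r 0 - ρ 0)).trans ?_)
    have := mul_le_mul_of_nonneg_right (hB 0 h0m).2.1 (norm_nonneg (r 0 - ρ 0))
    exact mul_le_mul_of_nonneg_left this hn.le
  have hlow : k * τ * q ^ 2 / 4 * ε ^ 2 ≤ Fintype.card V * (C * ε * ‖r 0 - ρ 0‖) := by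
    have e : -(k * (ε * q / 2) ^ 2) * (T - (T - τ)) = -(k * τ * q ^ 2 / 4 * ε ^ 2) := by ring
    rw [e] at hdec1
    linarith
  have e2 : k * τ * q ^ 2 / (4 * (Fintype.card V * C)) * ε
      = (k * τ * q ^ 2 / 4 * ε ^ 2) / (Fintype.card V * C * ε) := by
    field_simp
  rw [e2, div_le_iff₀ (by positivity)]
  linarith

/-- Terminal densities can be moved to first order in any direction `p` that is not constant along
some edge, by perturbing the initial value of `S` alone. The perturbation is found by duality: the
symplectic form of two perturbations of a trajectory is conserved up to higher order. -/
theorem SolvesCoupledSystem.exists_terminal_shift [Nonempty V] (hw : ∀ i j, w i j = w j i)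
    (hw_pos : ∀ i j, Γ.Adj i j → 0 < w i j) (hT : 0 < T) {F : (V → ℝ) → ℝ}
    (hF : ConvexOn ℝ (stdSimplex ℝ V) F) (hf : IsFirstVariation F f)
    (hf1 : ContDiffOn ℝ 1 f (openSimplex V)) (h : SolvesCoupledSystem Γ w f T ρ S)
    {p : V → ℝ} {i₀ j₀ : V} (hadj : Γ.Adj i₀ j₀) (hp : p i₀ ≠ p j₀) :
    ∃ c > 0, ∃ B > 0, ∀ᶠ ε in 𝓝[>] (0 : ℝ), ∃ r s, SolvesCoupledSystem Γ w f T r s ∧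
      r 0 = ρ 0 ∧ ‖r T - ρ T‖ ≤ B * ε ∧ ‖s T - S T‖ ≤ B * ε ∧
      c * ε ≤ ∑ i, p i * (r T i - ρ T i) := by
  have h0m : (0 : ℝ) ∈ Icc 0 T := ⟨le_rfl, hT.le⟩
  have hTm : T ∈ Icc 0 T := ⟨hT.le, le_rfl⟩
  obtain ⟨δ₁, hδ₁, C, hC, c, hc, H₁⟩ := h.exists_backward_gap hw hw_pos hT hF hf hf1 hadj hp
  obtain ⟨δ₂, hδ₂, C₂, hC₂, H₂⟩ := h.exists_nearby hw hT.le hf1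
  set B := C + C₂ * C with hB
  have hB0 : 0 < B := by positivity
  have hK : IsCompact (ρ '' Icc 0 T) := isCompact_Icc.image_of_continuousOn h.continuousOn_density
  obtain ⟨δ₃, hδ₃, H₃⟩ := hf.exists_increment_symm hf1 hK
    (by rintro _ ⟨t, ht, rfl⟩; exact h.mem_openSimplex t ht)
    (show 0 < c ^ 2 / (4 * T * B ^ 2) by positivity)
  set W := 6 * ∑ i, ∑ j ∈ Γ.neighborFinset i, |w i j| with hW
  refine ⟨c ^ 2 / 2, by positivity, B, hB0, ?_⟩
  filter_upwards [self_mem_nhdsWithin, eventually_mul_lt 1 hδ₁, eventually_mul_lt C hδ₂,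
    eventually_mul_lt B hδ₃, eventually_mul_lt (T * W * B ^ 3) (show 0 < c ^ 2 / 4 by positivity)]
    with ε hε h1 h2 h3 h4
  have hε : 0 < ε := hε
  obtain ⟨r', s', hrs', hr'T, hs'T, hb', hgap⟩ := H₁ ε hε (by linarith)
  set a := r' 0 - ρ 0 with ha
  have haC : ‖a‖ ≤ C * ε := (hb' 0 h0m).1
  have hna : ‖S 0 - a - S 0‖ = ‖a‖ := by rw [sub_sub_cancel_left, norm_neg]
  obtain ⟨r, s, hrs, hr0, hs0, hb⟩ := H₂ (S 0 - a) (by rw [hna]; linarith)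
  rw [hna] at hb
  have hCB : C * ε ≤ B * ε := by
    have : 0 ≤ C₂ * C * ε := by positivity
    rw [hB]; linarith
  have hCB' : C₂ * ‖a‖ ≤ B * ε := by
    have := mul_le_mul_of_nonneg_left haC hC₂.le
    have h0 : 0 ≤ C * ε := by positivity
    rw [hB]; linarith
  have hb1 : ∀ t ∈ Icc 0 T, ‖r t - ρ t‖ ≤ B * ε := fun t ht => (hb t ht).1.trans hCB'
  have hb2 : ∀ t ∈ Icc 0 T, ‖s t - S t‖ ≤ B * ε := fun t ht => (hb t ht).2.trans hCB'
  have hb3 : ∀ t ∈ Icc 0 T, ‖r' t - ρ t‖ ≤ B * ε := fun t ht => (hb' t ht).1.trans hCB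
  have hb4 : ∀ t ∈ Icc 0 T, ‖s' t - S t‖ ≤ B * ε := fun t ht => (hb' t ht).2.trans hCB
  refine ⟨r, s, hrs, hr0, hb1 T hTm, hb2 T hTm, ?_⟩
  set ω : ℝ → ℝ := fun t => ∑ i, ((r t i - ρ t i) * (s' t i - S t i)
    - (s t i - S t i) * (r' t i - ρ t i)) with hω
  have hω' : ∀ t ∈ Icc 0 T, HasDerivWithinAt ω _ (Icc 0 T) t := fun t ht =>
    HasDerivWithinAt.fun_sum (u := Finset.univ) fun i _ =>
    (((hrs.continuity t ht i).sub (h.continuity t ht i)).mul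
      ((hrs'.hamiltonJacobi t ht i).sub (h.hamiltonJacobi t ht i))).sub
      (((hrs.hamiltonJacobi t ht i).sub (h.hamiltonJacobi t ht i)).mul
      ((hrs'.continuity t ht i).sub (h.continuity t ht i)))
  have hrate : ∀ t ∈ Icc 0 T, _ := fun t ht =>
    abs_symplectic_rate_le Γ hw f (hb1 t ht) (hb2 t ht) (hb3 t ht) (hb4 t ht)
      (κ := c ^ 2 / (4 * T * B ^ 2) * (B * ε) ^ 2)
      ((H₃ (ρ t) ⟨t, ht, rfl⟩ (r t) (hrs.mem_openSimplex t ht) (r' t)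
        (hrs'.mem_openSimplex t ht) ((hb1 t ht).trans_lt h3) ((hb3 t ht).trans_lt h3)).trans (by
          rw [sq (B * ε)]
          have := hb1 t ht
          have := hb3 t ht
          gcongr))
  have hcons := sub_le_of_hasDerivWithinAt_le hT.le (fun t ht => (hω' t ht).neg)
    (fun t ht => neg_le.1 (abs_le.1 (hrate t ht)).1)
  simp only [Pi.neg_apply, sub_zero] at hcons
  have hω0 : ω 0 = ∑ i, a i * a i := by
    simp only [hω, hr0, hs0, ha, Pi.sub_apply]
    exact Finset.sum_congr rfl fun i _ => by ring
  have hωT : ω T = ε * ∑ i, p i * (r T i - ρ T i) := by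
    simp only [hω, hr'T, hs'T, Pi.add_apply, Pi.smul_apply, smul_eq_mul, Finset.mul_sum]
    exact Finset.sum_congr rfl fun i _ => by ring
  have hlow : (c * ε) ^ 2 ≤ ω 0 := by
    rw [hω0]
    refine le_trans ?_ (norm_sq_le_sum_sq a)
    gcongr
  have e1 : c ^ 2 / (4 * T * B ^ 2) * (B * ε) ^ 2 * T = c ^ 2 / 4 * ε ^ 2 := by
    field_simp
  have e2 : W * (B * ε) ^ 3 * T = (T * W * B ^ 3 * ε) * ε ^ 2 := by ring
  have e3 : (T * W * B ^ 3 * ε) * ε ^ 2 ≤ c ^ 2 / 4 * ε ^ 2 :=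
    mul_le_mul_of_nonneg_right h4.le (sq_nonneg _)
  have hfin : c ^ 2 / 2 * ε * ε ≤ (∑ i, p i * (r T i - ρ T i)) * ε := by
    rw [add_mul, e1, e2] at hcons
    rw [hωT] at hcons
    have e4 : (c * ε) ^ 2 = c ^ 2 * ε ^ 2 := by ring
    have e5 : c ^ 2 / 2 * ε * ε = c ^ 2 / 2 * ε ^ 2 := by ring
    linarith
  exact le_of_mul_le_mul_right hfin hε

/-- The transversality condition: if no other initial value of `S` gives a lower cost, then
`S T - g (ρ T)` is constant on the graph. -/
theorem SolvesCoupledSystem.terminal_eq_of_adj [Nonempty V] (hw : ∀ i j, w i j = w j i)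
    (hw_pos : ∀ i j, Γ.Adj i j → 0 < w i j) (hT : 0 < T) {F G : (V → ℝ) → ℝ}
    {g : (V → ℝ) → V → ℝ} (hF : ConvexOn ℝ (stdSimplex ℝ V) F) (hf : IsFirstVariation F f)
    (hg : IsFirstVariation G g)
    (hf1 : ContDiffOn ℝ 1 f (openSimplex V)) (h : SolvesCoupledSystem Γ w f T ρ S)
    (hmin : ∀ r s, SolvesCoupledSystem Γ w f T r s → r 0 = ρ 0 →
      costIV Γ w F G T ρ S ≤ costIV Γ w F G T r s) {i j : V} (hij : Γ.Adj i j) :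
    S T i - g (ρ T) i = S T j - g (ρ T) j := by
  have hTm : T ∈ Icc 0 T := ⟨hT.le, le_rfl⟩
  by_contra hne
  obtain ⟨c, hc, B, hB, H⟩ := h.exists_terminal_shift hw hw_pos hT hF hf hf1
    (p := fun i => S T i - g (ρ T) i) hij hne
  have hn : (0 : ℝ) < Fintype.card V := by positivity
  obtain ⟨δ, hδ, HG⟩ := hg.exists_le_add (h.mem_openSimplex T hTm)
    (show 0 < c / (4 * B) by positivity)
  obtain ⟨ε, ⟨r, s, hrs, hr0, hrT, hsT, hlow⟩, hε, h1, h2⟩ :=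
    (H.and ((eventually_mem_nhdsWithin (a := (0 : ℝ)) (s := Ioi 0)).and ((eventually_mul_lt B hδ).and
      (eventually_mul_lt (Fintype.card V * B ^ 2) (show 0 < c / 4 by positivity))))).exists
  have hε : 0 < ε := hε
  have hcost := hmin r s hrs hr0
  rw [costIV_eq_costPW hw_pos, costIV_eq_costPW hw_pos, costPW, costPW] at hcost
  have hact := hrs.action_le hw hw_pos hT.le hF hf hf1.continuousOn
    (by rw [hr0]; exact h.isPWAdmissible hw hw_pos hT.le hf)
  have hGle := HG (r T) (hrs.mem_openSimplex T hTm).1 (hrT.trans_lt h1)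
  have hrem : c / (4 * B) * ‖r T - ρ T‖ ≤ c / 4 * ε := by
    calc c / (4 * B) * ‖r T - ρ T‖ ≤ c / (4 * B) * (B * ε) := by gcongr
      _ = c / 4 * ε := by field_simp
  have hcross : |∑ i, (s T - S T) i * (r T - ρ T) i| ≤ c / 4 * ε := by
    refine (abs_sum_mul_le _ _).trans ?_
    calc Fintype.card V * (‖s T - S T‖ * ‖r T - ρ T‖)
        ≤ Fintype.card V * ((B * ε) * (B * ε)) := by gcongr
      _ = (Fintype.card V * B ^ 2 * ε) * ε := by ring
      _ ≤ c / 4 * ε := by gcongr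
  have e : ∑ i, s T i * (ρ T i - r T i) + ∑ i, g (ρ T) i * (r T i - ρ T i)
      = -(∑ i, (S T i - g (ρ T) i) * (r T i - ρ T i))
        - ∑ i, (s T - S T) i * (r T - ρ T) i := by
    simp only [← Finset.sum_neg_distrib, ← Finset.sum_sub_distrib, ← Finset.sum_add_distrib]
    exact Finset.sum_congr rfl fun i _ => by simp only [Pi.sub_apply]; ring
  have := (abs_le.1 hcross).1
  have : 0 < c * ε := by positivity
  linarith

/-- Sufficiency of the Nash system: if `S T - g (ρ T)` is constant, the trajectory minimizes the
path-wise problem. -/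
theorem SolvesCoupledSystem.isPWMinimizer (hw : ∀ i j, w i j = w j i)
    (hw_pos : ∀ i j, Γ.Adj i j → 0 < w i j) (hT : 0 ≤ T) {F G : (V → ℝ) → ℝ}
    {g : (V → ℝ) → V → ℝ} (hF : ConvexOn ℝ (stdSimplex ℝ V) F)
    (hG : ConvexOn ℝ (stdSimplex ℝ V) G) (hf : IsFirstVariation F f)
    (hg : IsFirstVariation G g) (hfc : ContinuousOn f (openSimplex V))
    (h : SolvesCoupledSystem Γ w f T ρ S) {c : ℝ} (hc : ∀ i, S T i - g (ρ T) i = c) :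
    IsPWMinimizer Γ w F G (ρ 0) T ρ (fun t => velocity Γ w (S t)) := by
  have hTm : T ∈ Icc 0 T := ⟨hT, le_rfl⟩
  refine ⟨h.isPWAdmissible hw hw_pos hT hf, fun ρ' v' h' => ?_⟩
  have hact := h.action_le hw hw_pos hT hF hf hfc h'
  have hGle := hg.add_le hG (h.mem_openSimplex T hTm) (h'.mem_simplex T hTm)
  have e : ∑ i, S T i * (ρ' T i - ρ T i) = ∑ i, g (ρ T) i * (ρ' T i - ρ T i) := by
    have h1 : ∀ i, S T i * (ρ' T i - ρ T i)
        = g (ρ T) i * (ρ' T i - ρ T i) + c * (ρ' T i - ρ T i) := fun i => by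
      rw [← hc i]; ring
    simp only [h1, Finset.sum_add_distrib, ← Finset.mul_sum, Finset.sum_sub_distrib,
      (h'.mem_simplex T hTm).2, (h.mem_openSimplex T hTm).1.2, sub_self, mul_zero, add_zero]
  simp only [costPW]
  linarith

end TerminalCondition

/-! ### Variations of the flux -/

section FluxVariation

variable {V : Type*} [Fintype V] {Γ : SimpleGraph V} [DecidableRel Γ.Adj]
  {w : V → V → ℝ} {F G : (V → ℝ) → ℝ} {f g : (V → ℝ) → V → ℝ} {μ₀ : V → ℝ} {T : ℝ}
  {ρ : ℝ → V → ℝ} {v n : ℝ → V → V → ℝ}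

theorem integrable_Icc_iff {φ : ℝ → ℝ} (hT : 0 ≤ T) :
    IntervalIntegrable φ volume 0 T ↔ Integrable φ (volume.restrict (Icc 0 T)) :=
  intervalIntegrable_iff_integrableOn_Icc_of_le hT

theorem integrable_of_abs_le {φ ψ : ℝ → ℝ}
    (hψ : Integrable ψ (volume.restrict (Icc 0 T)))
    (hφ : AEMeasurable φ (volume.restrict (Icc 0 T))) (h : ∀ t ∈ Icc 0 T, |φ t| ≤ ψ t) :
    Integrable φ (volume.restrict (Icc 0 T)) :=
  hψ.mono' hφ.aestronglyMeasurable (ae_restrict_of_forall_mem measurableSet_Icc h)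

theorem integrable_of_continuousOn {φ : ℝ → ℝ} (h : ContinuousOn φ (Icc 0 T)) :
    Integrable φ (volume.restrict (Icc 0 T)) :=
  h.integrableOn_Icc

theorem continuousOn_of_eq_add_integral {x φ : ℝ → ℝ} {c : ℝ} (hT : 0 ≤ T)
    (hφ : IntervalIntegrable φ volume 0 T)
    (hx : ∀ t ∈ Icc 0 T, x t = c + ∫ s in (0 : ℝ)..t, φ s) : ContinuousOn x (Icc 0 T) := by
  have := intervalIntegral.continuousOn_primitive_interval' hφ left_mem_uIcc
  rw [uIcc_of_le hT] at this
  exact (continuousOn_const.add this).congr hx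

theorem IsPWAdmissible.continuousOn (hT : 0 ≤ T) (h : IsPWAdmissible Γ w F μ₀ T ρ v) :
    ContinuousOn ρ (Icc 0 T) :=
  continuousOn_pi.2 fun i => continuousOn_of_eq_add_integral hT (h.flux_integrable i).neg
    (c := μ₀ i) fun t ht => by
      rw [h.continuity t ht i, sub_eq_add_neg, ← intervalIntegral.integral_neg]; rfl

theorem exists_lower_bound [Nonempty V] (hT : 0 ≤ T) (hρ : ContinuousOn ρ (Icc 0 T))
    (hpos : ∀ t ∈ Icc 0 T, ρ t ∈ openSimplex V) : ∃ m > 0, ∀ t ∈ Icc 0 T, ∀ i, m ≤ ρ t i := by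
  have : ∀ i, ∃ t₀ ∈ Icc 0 T, ∀ t ∈ Icc 0 T, ρ t₀ i ≤ ρ t i := fun i =>
    isCompact_Icc.exists_isMinOn ⟨0, le_rfl, hT⟩ (continuousOn_pi.1 hρ i)
  choose τ hτ hmin using this
  obtain ⟨i₀, hi₀⟩ := Finite.exists_min fun i => ρ (τ i) i
  exact ⟨ρ (τ i₀) i₀, (hpos _ (hτ i₀)).2 i₀, fun t ht i => (hi₀ i).trans (hmin i t ht)⟩

theorem theta_pos {V : Type*} {x : V → ℝ} (hx : ∀ i, 0 < x i) (i j : V) : 0 < theta x i j := by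
  have := hx i
  have := hx j
  simp only [theta]; positivity

/-- As long as the density stays away from zero, finite kinetic energy makes the velocities square
integrable. -/
theorem IsPWAdmissible.integrable_sq [Nonempty V] (hT : 0 ≤ T)
    (h : IsPWAdmissible Γ w F μ₀ T ρ v) {m : ℝ} (hm : 0 < m)
    (hlow : ∀ t ∈ Icc 0 T, ∀ i, m ≤ ρ t i) (i j : V) :
    Integrable (fun t => v t i j ^ 2) (volume.restrict (Icc 0 T)) := by
  by_cases hij : Γ.Adj i j
  · refine integrable_of_abs_le (((integrable_Icc_iff hT).1 h.kinetic_integrable).const_mul (4 / m))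
      ((h.measurable i j).pow_const 2) fun t ht => ?_
    rw [abs_of_nonneg (sq_nonneg _), kinetic_eq, div_mul_eq_mul_div, le_div_iff₀ hm]
    have hpos : ∀ i, 0 < ρ t i := fun i => hm.trans_le (hlow t ht i)
    have hnn : ∀ i j, 0 ≤ v t i j ^ 2 * theta (ρ t) i j := fun i j =>
      mul_nonneg (sq_nonneg _) (theta_pos hpos i j).le
    have h1 := Finset.single_le_sum (f := fun i => ∑ j ∈ Γ.neighborFinset i,
      v t i j ^ 2 * theta (ρ t) i j) (fun i _ => Finset.sum_nonneg fun j _ => hnn i j)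
      (Finset.mem_univ i)
    have h2 := Finset.single_le_sum (f := fun j => v t i j ^ 2 * theta (ρ t) i j)
      (fun j _ => hnn i j) (show j ∈ Γ.neighborFinset i by simpa using hij)
    have h3 : m ≤ theta (ρ t) i j := by
      have := hlow t ht i
      have := hlow t ht j
      simp only [theta]; linarith
    have h4 := mul_le_mul_of_nonneg_left h3 (sq_nonneg (v t i j))
    linarith
  · refine (integrable_zero ℝ ℝ _).congr ?_
    filter_upwards [ae_restrict_mem measurableSet_Icc] with t ht
    rw [(h.vectorField t ht).2 i j hij]; simp

/-- A `C¹` first variation is Lipschitz in a uniform neighbourhood of a compact set of densities. -/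
theorem exists_lipschitz_near [Nonempty V] (hf1 : ContDiffOn ℝ 1 f (openSimplex V))
    {K : Set (V → ℝ)} (hK : IsCompact K) (hKs : K ⊆ openSimplex V) :
    ∃ δ > 0, ∃ L ≥ 0, ∀ a ∈ K, ∀ x ∈ openSimplex V, ‖x - a‖ < δ →
      ‖f x - f a‖ ≤ L * ‖x - a‖ := by
  obtain ⟨Y, hY, hYs, δ, hδ, -, hYf⟩ := exists_contDiff_cutoff isOpen_massDomain
    (contDiffOn_comp_massProj hf1) hK (hKs.trans openSimplex_subset_massDomain)
  obtain ⟨L, hL⟩ := hY.lipschitzWith_of_hasCompactSupport hYs one_ne_zero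
  refine ⟨δ, hδ, L, L.2, fun a ha x hx hxa => ?_⟩
  have h1 : Y x = f x := by
    rw [hYf (Metric.mem_thickening_iff.2 ⟨a, ha, by rwa [dist_eq_norm]⟩)]
    simp only [massProj_of_sum_eq_one hx.1.2]
  have h2 : Y a = f a := by
    rw [hYf (Metric.self_subset_thickening hδ _ ha)]
    simp only [massProj_of_sum_eq_one (hKs ha).1.2]
  rw [← h1, ← h2]
  exact hL.norm_sub_le x a

/-- The exact second-order expansion of the edge energy `(vθ + εn)² / (θ + εd)`. -/
theorem edge_energy_expansion {v n θ d ε : ℝ} (h : θ + ε * d ≠ 0) :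
    ((v * θ + ε * n) / (θ + ε * d)) ^ 2 * (θ + ε * d)
      = v ^ 2 * θ + ε * (2 * v * n - v ^ 2 * d) + ε ^ 2 * ((n - v * d) ^ 2 / (θ + ε * d)) := by
  field_simp
  ring

/-- First-order optimality with respect to the flux: moving the flux `vθ` of a minimizer in a
bounded direction `n`, and the density accordingly by `δ`, does not decrease the cost to first
order. -/
theorem IsPWMinimizer.first_variation_nonneg [Nonempty V]
    (hT : 0 < T) (hF : ConvexOn ℝ (stdSimplex ℝ V) F) (hf : IsFirstVariation F f)
    (hg : IsFirstVariation G g) (hf1 : ContDiffOn ℝ 1 f (openSimplex V))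
    (hw : ∀ i j, w i j = w j i)
    (h : IsPWMinimizer Γ w F G μ₀ T ρ v) (hpos : ∀ t ∈ Icc 0 T, ρ t ∈ openSimplex V)
    (hn_meas : ∀ i j, AEMeasurable (fun t => n t i j) (volume.restrict (Icc 0 T)))
    (hn : ∀ t ∈ Icc 0 T, IsVectorField Γ (n t)) (hn1 : ∀ t ∈ Icc 0 T, ∀ i j, |n t i j| ≤ 1)
    {δ : ℝ → V → ℝ} (hδ : ∀ t ∈ Icc 0 T, ∀ i, δ t i
      = ∫ s in (0 : ℝ)..t, ∑ j ∈ Γ.neighborFinset i, Real.sqrt (w i j) * n s i j) :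
    IntervalIntegrable (fun t => (1 / 4) * ∑ i, ∑ j ∈ Γ.neighborFinset i,
        (2 * v t i j * n t i j - v t i j ^ 2 * theta (δ t) i j)
        + ∑ i, f (ρ t) i * δ t i) volume 0 T ∧
    0 ≤ (∫ t in (0 : ℝ)..T, ((1 / 4) * ∑ i, ∑ j ∈ Γ.neighborFinset i,
        (2 * v t i j * n t i j - v t i j ^ 2 * theta (δ t) i j)
        + ∑ i, f (ρ t) i * δ t i)) + ∑ i, g (ρ T) i * δ T i := by
  obtain ⟨hadm, hopt⟩ := h
  have h0m : (0 : ℝ) ∈ Icc 0 T := ⟨le_rfl, hT.le⟩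
  have hTm : T ∈ Icc 0 T := ⟨hT.le, le_rfl⟩
  have hρc := hadm.continuousOn hT.le
  obtain ⟨m, hm, hlow⟩ := exists_lower_bound hT.le hρc hpos
  obtain ⟨δf, hδf, L, hL, hLip⟩ := exists_lipschitz_near hf1
    (isCompact_Icc.image_of_continuousOn hρc) (by rintro _ ⟨t, ht, rfl⟩; exact hpos t ht)
  -- the density rate `ν` of the variation, and bounds for the variation `δ`
  set ν : ℝ → V → ℝ := fun t i => ∑ j ∈ Γ.neighborFinset i, Real.sqrt (w i j) * n t i j with hν
  set W := ∑ i, ∑ j ∈ Γ.neighborFinset i, Real.sqrt (w i j) with hW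
  have hW0 : 0 ≤ W := Finset.sum_nonneg fun i _ => Finset.sum_nonneg fun j _ => Real.sqrt_nonneg _
  have hνW : ∀ t ∈ Icc 0 T, ∀ i, |ν t i| ≤ W := by
    intro t ht i
    refine (Finset.abs_sum_le_sum_abs _ _).trans ?_
    refine le_trans (Finset.sum_le_sum fun j _ => ?_)
      (Finset.single_le_sum (f := fun i => ∑ j ∈ Γ.neighborFinset i, Real.sqrt (w i j))
        (fun i _ => Finset.sum_nonneg fun j _ => Real.sqrt_nonneg _) (Finset.mem_univ i))
    rw [abs_mul, abs_of_nonneg (Real.sqrt_nonneg _)]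
    exact mul_le_of_le_one_right (Real.sqrt_nonneg _) (hn1 t ht i j)
  have hν_meas : ∀ i, AEMeasurable (fun t => ν t i) (volume.restrict (Icc 0 T)) := fun i =>
    Finset.aemeasurable_fun_sum _ fun j _ => (hn_meas i j).const_mul _
  have hνI : ∀ i, IntervalIntegrable (fun t => ν t i) volume 0 T := fun i =>
    (integrable_Icc_iff hT.le).2 (integrable_of_abs_le
      (integrable_of_continuousOn (continuousOn_const (c := W))) (hν_meas i)
      fun t ht => hνW t ht i)
  have hδc : ContinuousOn δ (Icc 0 T) := continuousOn_pi.2 fun i =>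
    continuousOn_of_eq_add_integral hT.le (hνI i) (c := 0) fun t ht => by
      rw [hδ t ht i, zero_add]
  have hδci := continuousOn_pi.1 hδc
  set Δ := W * T + 1 with hΔ
  have hΔ0 : 0 < Δ := by positivity
  have hδΔ : ∀ t ∈ Icc 0 T, ‖δ t‖ ≤ Δ := by
    intro t ht
    rw [pi_norm_le_iff_of_nonneg hΔ0.le]
    intro i
    rw [hδ t ht i]
    refine (intervalIntegral.norm_integral_le_of_norm_le_const (C := W) fun s hs => ?_).trans ?_
    · rw [uIoc_of_le ht.1] at hs
      exact hνW s ⟨hs.1.le, hs.2.trans ht.2⟩ i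
    · rw [sub_zero, abs_of_nonneg ht.1]
      have := mul_le_mul_of_nonneg_left ht.2 hW0
      linarith
  have hνsum : ∀ t ∈ Icc 0 T, ∑ i, ν t i = 0 := by
    intro t ht
    have := sum_mul_sum_skew Γ (m := fun i j => Real.sqrt (w i j) * n t i j) (fun i j => by
      rw [hw i j, (hn t ht).1 i j]; ring) (fun _ => 1)
    simpa [hν] using this
  have hδsum : ∀ t ∈ Icc 0 T, ∑ i, δ t i = 0 := by
    intro t ht
    have hsub : uIcc 0 t ⊆ uIcc 0 T := by
      rw [uIcc_of_le ht.1, uIcc_of_le hT.le]; exact Icc_subset_Icc le_rfl ht.2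
    rw [Finset.sum_congr rfl fun i _ => hδ t ht i,
      ← intervalIntegral.integral_finsetSum fun i _ => (hνI i).mono_set hsub]
    rw [intervalIntegral.integral_congr (g := fun _ => (0 : ℝ)) fun s hs => ?_]
    · simp
    · rw [uIcc_of_le ht.1] at hs
      exact hνsum s ⟨hs.1, hs.2.trans ht.2⟩
  have hθδ : ∀ t ∈ Icc 0 T, ∀ i j, |theta (δ t) i j| ≤ Δ := fun t ht i j =>
    (abs_theta_le _ i j).trans (hδΔ t ht)
  have hθc : ∀ i j, ContinuousOn (fun t => theta (δ t) i j) (Icc 0 T) := fun i j => by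
    have h1 := hδci i
    have h2 := hδci j
    simp only [theta]; fun_prop
  have hθρc : ∀ i j, ContinuousOn (fun t => theta (ρ t) i j) (Icc 0 T) := fun i j => by
    have h1 := continuousOn_pi.1 hρc i
    have h2 := continuousOn_pi.1 hρc j
    simp only [theta]; fun_prop
  have hθm : ∀ i j, AEMeasurable (fun t => theta (δ t) i j) (volume.restrict (Icc 0 T)) :=
    fun i j => (hθc i j).aemeasurable measurableSet_Icc
  have hv_meas := hadm.measurable
  have hv2 := hadm.integrable_sq hT.le hm hlow
  have hone : Integrable (fun _ : ℝ => (1 : ℝ)) (volume.restrict (Icc 0 T)) :=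
    integrable_of_continuousOn continuousOn_const
  -- integrability of the first- and second-order terms
  have hI1 : ∀ i j, Integrable (fun t => 2 * v t i j * n t i j - v t i j ^ 2 * theta (δ t) i j)
      (volume.restrict (Icc 0 T)) := fun i j => by
    refine integrable_of_abs_le (hone.add ((hv2 i j).const_mul (1 + Δ)))
      ((((hv_meas i j).const_mul 2).mul (hn_meas i j)).sub
        (((hv_meas i j).pow_const 2).mul (hθm i j))) fun t ht => ?_
    have h1 : |2 * v t i j * n t i j| ≤ 1 + v t i j ^ 2 := by
      rw [abs_mul]
      have h2 := mul_le_of_le_one_right (abs_nonneg (2 * v t i j)) (hn1 t ht i j)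
      rw [abs_mul, abs_two] at h2
      rw [abs_mul, abs_two]
      have h3 := sq_abs (v t i j)
      have h4 := sq_nonneg (|v t i j| - 1)
      linarith
    have h2 : |v t i j ^ 2 * theta (δ t) i j| ≤ v t i j ^ 2 * Δ := by
      rw [abs_mul, abs_of_nonneg (sq_nonneg _)]
      exact mul_le_mul_of_nonneg_left (hθδ t ht i j) (sq_nonneg _)
    refine (abs_sub _ _).trans ?_
    simp only [Pi.add_apply]
    linarith
  have hI2 : ∀ i j, Integrable (fun t => (n t i j - v t i j * theta (δ t) i j) ^ 2)
      (volume.restrict (Icc 0 T)) := fun i j => by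
    refine integrable_of_abs_le ((hone.const_mul 2).add ((hv2 i j).const_mul (2 * Δ ^ 2)))
      (((hn_meas i j).sub ((hv_meas i j).mul (hθm i j))).pow_const 2) fun t ht => ?_
    rw [abs_of_nonneg (sq_nonneg _)]
    have h1 : n t i j ^ 2 ≤ 1 := (sq_le_one_iff_abs_le_one _).2 (hn1 t ht i j)
    have h2 : theta (δ t) i j ^ 2 ≤ Δ ^ 2 := sq_le_sq' (abs_le.1 (hθδ t ht i j)).1
      (abs_le.1 (hθδ t ht i j)).2
    have h3 := mul_le_mul_of_nonneg_left h2 (sq_nonneg (v t i j))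
    have h4 := sq_nonneg (n t i j + v t i j * theta (δ t) i j)
    simp only [Pi.add_apply]
    nlinarith
  have hfδ : Integrable (fun t => ∑ i, f (ρ t) i * δ t i) (volume.restrict (Icc 0 T)) := by
    refine integrable_of_continuousOn ?_
    have h1 := continuousOn_pi.1 (hf1.continuousOn.comp hρc hpos)
    refine continuousOn_finsetSum _ fun i _ => (h1 i).mul (hδci i)
  set K1 : ℝ → ℝ := fun t => (1 / 4) * ∑ i, ∑ j ∈ Γ.neighborFinset i,
        (2 * v t i j * n t i j - v t i j ^ 2 * theta (δ t) i j) with hK1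
  have hK1I : Integrable K1 (volume.restrict (Icc 0 T)) :=
    (integrable_finsetSum _ fun i _ => integrable_finsetSum _ fun j _ => hI1 i j).const_mul _
  set R : ℝ → ℝ := fun t => (1 / 4) * ∑ i, ∑ j ∈ Γ.neighborFinset i,
        (n t i j - v t i j * theta (δ t) i j) ^ 2 * (2 / m) with hR
  have hRI : Integrable R (volume.restrict (Icc 0 T)) :=
    (integrable_finsetSum _ fun i _ => integrable_finsetSum _ fun j _ =>
      (hI2 i j).mul_const _).const_mul _
  have hKI := (integrable_Icc_iff hT.le).1 hadm.kinetic_integrable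
  have hDI : IntervalIntegrable (fun t => K1 t + ∑ i, f (ρ t) i * δ t i) volume 0 T :=
    (integrable_Icc_iff hT.le).2 (hK1I.add hfδ)
  refine ⟨hDI, ?_⟩
  -- the cost of the varied pair, to second order in `ε`
  set A := Fintype.card V * (L * Δ ^ 2) with hA
  have hvar : ∀ ε > 0, ε * Δ ≤ m / 2 → ε * Δ < δf →
      (∀ t ∈ Icc 0 T, ρ t + ε • δ t ∈ openSimplex V) ∧
      0 ≤ ε * (∫ t in (0 : ℝ)..T, (K1 t + ∑ i, f (ρ t) i * δ t i))
        + ε ^ 2 * (∫ t in (0 : ℝ)..T, (R t + A)) + (G (ρ T + ε • δ T) - G (ρ T)) := by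
    intro ε hε hεm hεf
    have hεδ : ∀ t ∈ Icc 0 T, ‖ε • δ t‖ ≤ ε * Δ := fun t ht => by
      rw [norm_smul, Real.norm_eq_abs, abs_of_pos hε]
      exact mul_le_mul_of_nonneg_left (hδΔ t ht) hε.le
    set ρε : ℝ → V → ℝ := fun t => ρ t + ε • δ t with hρε
    have hρεlow : ∀ t ∈ Icc 0 T, ∀ i, m / 2 ≤ ρε t i := fun t ht i => by
      have h1 := hlow t ht i
      have h2 := (norm_le_pi_norm (ε • δ t) i).trans (hεδ t ht)
      rw [Real.norm_eq_abs] at h2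
      have h3 := (abs_le.1 h2).1
      simp only [hρε, Pi.add_apply]
      linarith
    have hmem : ∀ t ∈ Icc 0 T, ρε t ∈ openSimplex V := fun t ht => by
      have h1 : ∀ i, 0 < ρε t i := fun i => (half_pos hm).trans_le (hρεlow t ht i)
      refine ⟨⟨fun i => (h1 i).le, ?_⟩, h1⟩
      simp only [hρε, Pi.add_apply, Pi.smul_apply, smul_eq_mul, Finset.sum_add_distrib,
        ← Finset.mul_sum, (hpos t ht).1.2, hδsum t ht, mul_zero, add_zero]
    refine ⟨hmem, ?_⟩
    have hθε : ∀ t i j, theta (ρε t) i j = theta (ρ t) i j + ε * theta (δ t) i j := by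
      intro t i j
      simp only [hρε, theta, Pi.add_apply, Pi.smul_apply, smul_eq_mul]; ring
    have hθlow : ∀ t ∈ Icc 0 T, ∀ i j, m / 2 ≤ theta (ρε t) i j := fun t ht i j => by
      have h1 := hρεlow t ht i
      have h2 := hρεlow t ht j
      simp only [theta]; linarith
    have hθpos : ∀ t ∈ Icc 0 T, ∀ i j, 0 < theta (ρε t) i j := fun t ht i j =>
      (half_pos hm).trans_le (hθlow t ht i j)
    set vε : ℝ → V → V → ℝ := fun t i j =>
      (v t i j * theta (ρ t) i j + ε * n t i j) / theta (ρε t) i j with hvε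
    have hρεc : ContinuousOn ρε (Icc 0 T) := hρc.add (hδc.const_smul ε)
    have hθεc : ∀ i j, ContinuousOn (fun t => theta (ρε t) i j) (Icc 0 T) := fun i j => by
      have h1 := continuousOn_pi.1 hρεc i
      have h2 := continuousOn_pi.1 hρεc j
      simp only [theta]; fun_prop
    have hvε_meas : ∀ i j, AEMeasurable (fun t => vε t i j) (volume.restrict (Icc 0 T)) :=
      fun i j => (((hv_meas i j).mul ((hθρc i j).aemeasurable measurableSet_Icc)).add
        ((hn_meas i j).const_mul ε)).div ((hθεc i j).aemeasurable measurableSet_Icc)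
    have hdiv : ∀ t ∈ Icc 0 T, ∀ i, divG Γ w (ρε t) (vε t) i
        = divG Γ w (ρ t) (v t) i - ε * ν t i := by
      intro t ht i
      have h1 : ∀ j, vε t i j * theta (ρε t) i j = v t i j * theta (ρ t) i j + ε * n t i j :=
        fun j => div_mul_cancel₀ _ (hθpos t ht i j).ne'
      simp only [divG, hν, mul_assoc, h1, Finset.mul_sum]
      rw [← neg_add', ← Finset.sum_add_distrib]
      congr 1
      exact Finset.sum_congr rfl fun j _ => by ring
    have hkin_le : ∀ t ∈ Icc 0 T, kinetic Γ (ρε t) (vε t)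
        ≤ kinetic Γ (ρ t) (v t) + ε * K1 t + ε ^ 2 * R t := by
      intro t ht
      rw [kinetic_eq, kinetic_eq]
      simp only [hK1, hR, Finset.mul_sum, ← Finset.sum_add_distrib]
      refine Finset.sum_le_sum fun i _ => Finset.sum_le_sum fun j _ => ?_
      have h1 := hθpos t ht i j
      have h2 := hθlow t ht i j
      simp only [hvε]
      rw [hθε] at h1 h2 ⊢
      rw [edge_energy_expansion h1.ne']
      have h3 : (n t i j - v t i j * theta (δ t) i j) ^ 2 / (theta (ρ t) i j + ε * theta (δ t) i j)
          ≤ (n t i j - v t i j * theta (δ t) i j) ^ 2 * (2 / m) := by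
        rw [div_eq_mul_inv]
        refine mul_le_mul_of_nonneg_left ?_ (sq_nonneg _)
        calc _ ≤ (m / 2)⁻¹ := inv_anti₀ (half_pos hm) h2
          _ = 2 / m := inv_div _ _
      have h4 := mul_le_mul_of_nonneg_left h3 (sq_nonneg ε)
      linarith
    have hkin_nn : ∀ t ∈ Icc 0 T, 0 ≤ kinetic Γ (ρε t) (vε t) := fun t ht => by
      rw [kinetic_eq]
      exact mul_nonneg (by norm_num) (Finset.sum_nonneg fun i _ => Finset.sum_nonneg fun j _ =>
        mul_nonneg (sq_nonneg _) (hθpos t ht i j).le)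
    have hkin_meas : AEMeasurable (fun t => kinetic Γ (ρε t) (vε t))
        (volume.restrict (Icc 0 T)) := by
      simp only [kinetic_eq]
      exact (Finset.aemeasurable_fun_sum _ fun i _ => Finset.aemeasurable_fun_sum _ fun j _ =>
        ((hvε_meas i j).pow_const 2).mul
          ((hθεc i j).aemeasurable measurableSet_Icc)).const_mul _
    have hkinI : IntervalIntegrable (fun t => kinetic Γ (ρε t) (vε t)) volume 0 T := by
      refine (integrable_Icc_iff hT.le).2 (integrable_of_abs_le
        ((hKI.add (hK1I.const_mul ε)).add (hRI.const_mul (ε ^ 2))) hkin_meas fun t ht => ?_)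
      rw [abs_of_nonneg (hkin_nn t ht)]
      exact hkin_le t ht
    have hFI : IntervalIntegrable (fun t => F (ρε t)) volume 0 T :=
      (integrable_Icc_iff hT.le).2 (integrable_of_continuousOn (hf.continuousOn_comp hρεc hmem))
    have hdivI : ∀ i, IntervalIntegrable (fun t => divG Γ w (ρ t) (v t) i - ε * ν t i)
        volume 0 T := fun i => (hadm.flux_integrable i).sub ((hνI i).const_mul ε)
    have hadmε : IsPWAdmissible Γ w F μ₀ T ρε vε := by
      refine ⟨fun t ht => (hmem t ht).1, fun t ht => ⟨fun i j => ?_, fun i j hij => ?_⟩, hvε_meas,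
        hkinI, hFI, fun i => ?_, fun t ht i => ?_⟩
      · simp only [hvε]
        rw [(hadm.vectorField t ht).1 i j, (hn t ht).1 i j, theta_comm _ i j,
          theta_comm (ρε t) i j]
        ring
      · simp only [hvε]
        rw [(hadm.vectorField t ht).2 i j hij, (hn t ht).2 i j hij]
        simp
      · refine (hdivI i).congr fun t ht => ?_
        rw [uIoc_of_le hT.le] at ht
        exact (hdiv t (Ioc_subset_Icc_self ht) i).symm
      · have hsub : uIcc 0 t ⊆ uIcc 0 T := by
          rw [uIcc_of_le ht.1, uIcc_of_le hT.le]; exact Icc_subset_Icc le_rfl ht.2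
        rw [intervalIntegral.integral_congr (g := fun s => divG Γ w (ρ s) (v s) i - ε * ν s i)
          fun s hs => ?_]
        · rw [intervalIntegral.integral_sub ((hadm.flux_integrable i).mono_set hsub)
            (((hνI i).const_mul ε).mono_set hsub), intervalIntegral.integral_const_mul,
            ← hδ t ht i]
          simp only [hρε, Pi.add_apply, Pi.smul_apply, smul_eq_mul]
          rw [hadm.continuity t ht i]; ring
        · rw [uIcc_of_le ht.1] at hs
          exact hdiv s ⟨hs.1, hs.2.trans ht.2⟩ i
    have hF_le : ∀ t ∈ Icc 0 T, F (ρε t)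
        ≤ F (ρ t) + ε * (∑ i, f (ρ t) i * δ t i) + ε ^ 2 * A := by
      intro t ht
      have h1 := hf.add_le hF (hmem t ht) (hpos t ht).1
      have hd : ρε t - ρ t = ε • δ t := by simp [hρε]
      have h2 := hLip (ρ t) ⟨t, ht, rfl⟩ (ρε t) (hmem t ht)
        (by rw [hd]; exact (hεδ t ht).trans_lt hεf)
      rw [hd] at h2
      have h3 := (le_abs_self _).trans (abs_sum_mul_le (f (ρε t) - f (ρ t)) (ε • δ t))
      have h4 : ‖f (ρε t) - f (ρ t)‖ * ‖ε • δ t‖ ≤ L * (ε * Δ) * (ε * Δ) := by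
        have := hεδ t ht
        refine mul_le_mul (h2.trans ?_) this (norm_nonneg _) (by positivity)
        gcongr
      have h5 := mul_le_mul_of_nonneg_left h4 (Nat.cast_nonneg (α := ℝ) (Fintype.card V))
      have e1 : ∑ i, f (ρε t) i * (ρ t i - ρε t i) = -(∑ i, (f (ρε t) - f (ρ t)) i * (ε • δ t) i)
          - ε * ∑ i, f (ρ t) i * δ t i := by
        rw [Finset.mul_sum, ← Finset.sum_neg_distrib, ← Finset.sum_sub_distrib]
        refine Finset.sum_congr rfl fun i _ => ?_
        simp only [hρε, Pi.add_apply, Pi.sub_apply, Pi.smul_apply, smul_eq_mul]; ring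
      have e2 : Fintype.card V * (L * (ε * Δ) * (ε * Δ)) = ε ^ 2 * A := by rw [hA]; ring
      rw [e1] at h1
      linarith
    have hcost := hopt ρε vε hadmε
    simp only [costPW] at hcost
    have hRAI : IntervalIntegrable (fun t => R t + A) volume 0 T :=
      (integrable_Icc_iff hT.le).2
        (hRI.add (integrable_of_continuousOn (continuousOn_const (c := A))))
    have hLI := hadm.kinetic_integrable.add hadm.potential_integrable
    have hmono : ∫ t in (0 : ℝ)..T, (kinetic Γ (ρε t) (vε t) + F (ρε t))
        ≤ ∫ t in (0 : ℝ)..T, ((kinetic Γ (ρ t) (v t) + F (ρ t))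
          + ε * (K1 t + ∑ i, f (ρ t) i * δ t i) + ε ^ 2 * (R t + A)) := by
      refine intervalIntegral.integral_mono_on hT.le (hkinI.add hFI)
        ((hLI.add (hDI.const_mul ε)).add (hRAI.const_mul (ε ^ 2))) fun t ht => ?_
      have h1 := hkin_le t ht
      have h2 := hF_le t ht
      linarith
    rw [intervalIntegral.integral_add (hLI.add (hDI.const_mul ε)) (hRAI.const_mul (ε ^ 2)),
      intervalIntegral.integral_add hLI (hDI.const_mul ε), intervalIntegral.integral_const_mul,
      intervalIntegral.integral_const_mul] at hmono
    linarith
  by_contra hneg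
  push Not at hneg
  set D := (∫ t in (0 : ℝ)..T, (K1 t + ∑ i, f (ρ t) i * δ t i)) + ∑ i, g (ρ T) i * δ T i with hD
  obtain ⟨δG, hδG, HG⟩ := hg.exists_le_add (hpos T hTm)
    (show 0 < -D / (4 * Δ) from div_pos (neg_pos.2 hneg) (by positivity))
  set R₀ := ∫ t in (0 : ℝ)..T, (R t + A) with hR₀
  obtain ⟨ε, hε, h1, h2, h3, h4⟩ := ((eventually_mem_nhdsWithin (a := (0 : ℝ)) (s := Ioi 0)).and
    ((eventually_mul_lt Δ (half_pos hm)).and ((eventually_mul_lt Δ hδf).and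
      ((eventually_mul_lt Δ hδG).and
        (eventually_mul_lt R₀ (show 0 < -D / 4 by linarith)))))).exists
  have hε : 0 < ε := hε
  rw [mul_comm] at h1 h2 h3 h4
  obtain ⟨hmem, hmain⟩ := hvar ε hε h1.le h2
  have hn4 : ‖ρ T + ε • δ T - ρ T‖ ≤ ε * Δ := by
    rw [add_sub_cancel_left, norm_smul, Real.norm_eq_abs, abs_of_pos hε]
    exact mul_le_mul_of_nonneg_left (hδΔ T hTm) hε.le
  have hGle := HG _ (hmem T hTm).1 (hn4.trans_lt h3)
  have e1 : ∑ i, g (ρ T) i * ((ρ T + ε • δ T) i - ρ T i) = ε * ∑ i, g (ρ T) i * δ T i := by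
    rw [Finset.mul_sum]
    refine Finset.sum_congr rfl fun i _ => ?_
    simp only [Pi.add_apply, Pi.smul_apply, smul_eq_mul]; ring
  have h5 : -D / (4 * Δ) * ‖ρ T + ε • δ T - ρ T‖ ≤ -D / 4 * ε := by
    calc _ ≤ -D / (4 * Δ) * (ε * Δ) :=
          mul_le_mul_of_nonneg_left hn4 (div_nonneg (by linarith) (by positivity))
      _ = -D / 4 * ε := by field_simp
  have h6 : ε ^ 2 * R₀ ≤ -D / 4 * ε := by
    have := mul_le_mul_of_nonneg_left h4.le hε.le
    calc ε ^ 2 * R₀ = ε * (ε * R₀) := by ring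
      _ ≤ _ := by linarith
  have h7 : 0 < -D * ε := mul_pos (by linarith) hε
  have h8 : ε * (∫ t in (0 : ℝ)..T, (K1 t + ∑ i, f (ρ t) i * δ t i))
      + ε * ∑ i, g (ρ T) i * δ T i = D * ε := by rw [hD]; ring
  linarith

end FluxVariation

/-! ### Existence of the value function -/

section ValueFunction

variable {V : Type*} [Fintype V] {Γ : SimpleGraph V} [DecidableRel Γ.Adj]
  {w : V → V → ℝ} {F G : (V → ℝ) → ℝ} {f g : (V → ℝ) → V → ℝ} {μ₀ : V → ℝ} {T : ℝ}
  {ρ : ℝ → V → ℝ} {v : ℝ → V → V → ℝ}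

/-- A minimizer in the interior of the simplex has a value function: the primitive of
`∑ v_ij² / 4 - f_i(ρ)` with terminal value `g (ρ T)`. The relation `v = √w ∇S` is the
Euler–Lagrange equation with respect to the flux. -/
theorem IsPWMinimizer.exists_isValueFunction [Nonempty V]
    (hT : 0 < T) (hF : ConvexOn ℝ (stdSimplex ℝ V) F) (hf : IsFirstVariation F f)
    (hg : IsFirstVariation G g) (hf1 : ContDiffOn ℝ 1 f (openSimplex V))
    (hw : ∀ i j, w i j = w j i) (hw_pos : ∀ i j, Γ.Adj i j → 0 < w i j)
    (h : IsPWMinimizer Γ w F G μ₀ T ρ v) (hpos : ∀ t ∈ Icc 0 T, ρ t ∈ openSimplex V) :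
    ∃ S, IsValueFunction Γ w f g μ₀ T ρ v S := by
  have hadm := h.1
  have h0m : (0 : ℝ) ∈ Icc 0 T := ⟨le_rfl, hT.le⟩
  have hTm : T ∈ Icc 0 T := ⟨hT.le, le_rfl⟩
  have hρc := hadm.continuousOn hT.le
  obtain ⟨m, hm, hlow⟩ := exists_lower_bound hT.le hρc hpos
  have hv2 := hadm.integrable_sq hT.le hm hlow
  have hfc : ∀ i, ContinuousOn (fun t => f (ρ t) i) (Icc 0 T) :=
    continuousOn_pi.1 (hf1.continuousOn.comp hρc hpos)
  set α : ℝ → V → ℝ := fun t i =>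
    (1 / 4) * ∑ j ∈ Γ.neighborFinset i, v t i j ^ 2 - f (ρ t) i with hα
  have hαI : ∀ i, IntervalIntegrable (fun t => α t i) volume 0 T := fun i =>
    (integrable_Icc_iff hT.le).2 (((integrable_finsetSum _ fun j _ => hv2 i j).const_mul _).sub
      (integrable_of_continuousOn (hfc i)))
  set S : ℝ → V → ℝ := fun t i => (g (ρ T) i - ∫ s in (0 : ℝ)..T, α s i)
    + ∫ s in (0 : ℝ)..t, α s i with hS
  have hS0 : ∀ i, S 0 i = g (ρ T) i - ∫ s in (0 : ℝ)..T, α s i := fun i => by simp [hS]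
  have hST : S T = g (ρ T) := by ext i; simp [hS]
  have hSprim : ∀ i, ∀ t ∈ Icc 0 T, S t i = S 0 i + ∫ s in (0 : ℝ)..t, α s i := fun i t _ => by
    rw [hS0]
  have hSc : ContinuousOn S (Icc 0 T) := continuousOn_pi.2 fun i =>
    continuousOn_of_eq_add_integral hT.le (hαI i) (hSprim i)
  have hSci := continuousOn_pi.1 hSc
  -- the defect of the Euler–Lagrange equation, and a bounded flux opposite to it
  set u : ℝ → V → V → ℝ := fun t i j => v t i j - velocity Γ w (S t) i j with hu
  set n : ℝ → V → V → ℝ := fun t i j => -(u t i j / (1 + |u t i j|)) with hn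
  have hu_field : ∀ t ∈ Icc 0 T, IsVectorField Γ (u t) := fun t ht => by
    obtain ⟨h1, h2⟩ := hadm.vectorField t ht
    obtain ⟨h3, h4⟩ := isVectorField_velocity Γ hw (S t)
    refine ⟨fun i j => ?_, fun i j hij => ?_⟩
    · simp only [hu]; rw [h1 i j, h3 i j]; ring
    · simp only [hu]; rw [h2 i j hij, h4 i j hij, sub_zero]
  have hn_field : ∀ t ∈ Icc 0 T, IsVectorField Γ (n t) := fun t ht => by
    obtain ⟨h1, h2⟩ := hu_field t ht
    refine ⟨fun i j => ?_, fun i j hij => ?_⟩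
    · simp only [hn]; rw [h1 i j, abs_neg]; ring
    · simp only [hn]; rw [h2 i j hij]; simp
  have hu_meas : ∀ i j, AEMeasurable (fun t => u t i j) (volume.restrict (Icc 0 T)) :=
    fun i j => by
      refine (hadm.measurable i j).sub ?_
      by_cases hij : Γ.Adj i j
      · have h1 := hSci i
        have h2 := hSci j
        have : ContinuousOn (fun t => velocity Γ w (S t) i j) (Icc 0 T) := by
          simp only [velocity, hij, if_true]
          fun_prop
        exact this.aemeasurable measurableSet_Icc
      · simp [velocity, hij]
  have hn_meas : ∀ i j, AEMeasurable (fun t => n t i j) (volume.restrict (Icc 0 T)) :=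
    fun i j => by
      have h1 : AEMeasurable (fun t => |u t i j|) (volume.restrict (Icc 0 T)) := by
        simpa only [← Real.norm_eq_abs] using (hu_meas i j).norm
      exact ((hu_meas i j).div (h1.const_add 1)).neg
  have hn1 : ∀ t ∈ Icc 0 T, ∀ i j, |n t i j| ≤ 1 := fun t _ i j => by
    have h1 : 0 < 1 + |u t i j| := by positivity
    simp only [hn]
    rw [abs_neg, abs_div, abs_of_pos h1, div_le_one h1]
    linarith
  set ν : ℝ → V → ℝ := fun t i => ∑ j ∈ Γ.neighborFinset i, Real.sqrt (w i j) * n t i j with hν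
  have hνI : ∀ i, IntervalIntegrable (fun t => ν t i) volume 0 T := fun i => by
    refine (integrable_Icc_iff hT.le).2 (integrable_finsetSum _ fun j _ => Integrable.const_mul
      (integrable_of_abs_le (integrable_of_continuousOn (continuousOn_const (c := 1)))
        (hn_meas i j) fun t ht => hn1 t ht i j) _)
  set δ : ℝ → V → ℝ := fun t i => ∫ s in (0 : ℝ)..t, ν s i with hδ
  have hδ0 : ∀ i, δ 0 i = 0 := fun i => by simp [hδ]
  have hδprim : ∀ i, ∀ t ∈ Icc 0 T, δ t i = δ 0 i + ∫ s in (0 : ℝ)..t, ν s i := fun i t _ => by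
    rw [hδ0, zero_add]
  have hδci : ∀ i, ContinuousOn (fun t => δ t i) (Icc 0 T) := fun i =>
    continuousOn_of_eq_add_integral hT.le (hνI i) (hδprim i)
  obtain ⟨hI1, hvar⟩ := h.first_variation_nonneg hT hF hf hg hf1 hw hpos hn_meas hn_field hn1
    (δ := δ) (fun t _ i => rfl)
  -- integrating `⟨S, δ⟩` by parts turns the first variation into minus the defect
  have hparts := fun i => integral_by_parts_of_primitive hT.le (hαI i) (hνI i) (hSprim i)
    (hδprim i)
  have hIi : ∀ i, IntervalIntegrable (fun t => α t i * δ t i + S t i * ν t i) volume 0 T :=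
    fun i => ((hαI i).mul_continuousOn (by rw [uIcc_of_le hT.le]; exact hδci i)).add
      ((hνI i).continuousOn_mul (by rw [uIcc_of_le hT.le]; exact hSci i))
  have hI2 : IntervalIntegrable (fun t => ∑ i, (α t i * δ t i + S t i * ν t i)) volume 0 T := by
    rw [← Finset.sum_fn]
    exact IntervalIntegrable.sum _ fun i _ => hIi i
  set Q : ℝ → ℝ := fun t => (1 / 2) * ∑ i, ∑ j ∈ Γ.neighborFinset i,
    u t i j ^ 2 / (1 + |u t i j|) with hQ
  have hpt : ∀ t ∈ Icc 0 T, ((1 / 4) * ∑ i, ∑ j ∈ Γ.neighborFinset i,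
        (2 * v t i j * n t i j - v t i j ^ 2 * theta (δ t) i j)
        + ∑ i, f (ρ t) i * δ t i) + ∑ i, (α t i * δ t i + S t i * ν t i) = -Q t := by
    intro t ht
    obtain ⟨hv_skew, -⟩ := hadm.vectorField t ht
    have e1 := sum_mul_sum_symm Γ (A := fun i j => v t i j ^ 2)
      (fun i j => by rw [hv_skew i j, neg_sq]) (δ t)
    have e2 := sum_mul_sum_skew Γ (m := fun i j => Real.sqrt (w i j) * n t i j) (fun i j => by
      rw [hw i j, (hn_field t ht).1 i j]; ring) (S t)
    have e3 : ∑ i, (α t i * δ t i + S t i * ν t i)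
        = (1 / 4) * ∑ i, δ t i * ∑ j ∈ Γ.neighborFinset i, v t i j ^ 2
          - ∑ i, f (ρ t) i * δ t i
          + ∑ i, S t i * ∑ j ∈ Γ.neighborFinset i, Real.sqrt (w i j) * n t i j := by
      rw [Finset.mul_sum, ← Finset.sum_sub_distrib, ← Finset.sum_add_distrib]
      refine Finset.sum_congr rfl fun i _ => ?_
      simp only [hα, hν]; ring
    rw [e3, e1, e2]
    have e4 : -Q t = (1 / 4) * ∑ i, ∑ j ∈ Γ.neighborFinset i,
          (2 * v t i j * n t i j - v t i j ^ 2 * theta (δ t) i j)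
        + (1 / 4) * ∑ i, ∑ j ∈ Γ.neighborFinset i, v t i j ^ 2 * theta (δ t) i j
        + (1 / 2) * ∑ i, ∑ j ∈ Γ.neighborFinset i,
          (S t i - S t j) * (Real.sqrt (w i j) * n t i j) := by
      simp only [hQ, Finset.mul_sum, ← Finset.sum_add_distrib, ← Finset.sum_neg_distrib]
      refine Finset.sum_congr rfl fun i _ => Finset.sum_congr rfl fun j hj => ?_
      have hij : Γ.Adj i j := by simpa using hj
      have huij : u t i j = v t i j - Real.sqrt (w i j) * (S t j - S t i) := by
        simp only [hu, velocity, hij, if_true]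
      have hnu : u t i j * n t i j = -(u t i j ^ 2 / (1 + |u t i j|)) := by
        simp only [hn]; ring
      have : (1 / 2) * (u t i j * n t i j) = (1 / 2) *
          ((v t i j - Real.sqrt (w i j) * (S t j - S t i)) * n t i j) := by rw [← huij]
      rw [hnu] at this
      linear_combination this
    rw [e4]; ring
  have hQI : IntervalIntegrable Q volume 0 T := by
    refine ((hI1.add hI2).neg).congr fun t ht => ?_
    rw [uIoc_of_le hT.le] at ht
    have := hpt t (Ioc_subset_Icc_self ht)
    simp only [Pi.neg_apply]
    linarith
  have hQint : ∫ t in (0 : ℝ)..T, Q t ≤ 0 := by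
    have e1 : ∫ t in (0 : ℝ)..T, -Q t = (∫ t in (0 : ℝ)..T, ((1 / 4) * ∑ i,
        ∑ j ∈ Γ.neighborFinset i, (2 * v t i j * n t i j - v t i j ^ 2 * theta (δ t) i j)
        + ∑ i, f (ρ t) i * δ t i)) + ∑ i, g (ρ T) i * δ T i := by
      rw [← intervalIntegral.integral_congr (fun t ht => hpt t (by rwa [uIcc_of_le hT.le] at ht)),
        intervalIntegral.integral_add hI1 hI2,
        intervalIntegral.integral_finsetSum fun i _ => hIi i,
        Finset.sum_congr rfl fun i _ => hparts i]
      simp only [hST, hδ0, mul_zero, sub_zero]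
    rw [← e1, intervalIntegral.integral_neg] at hvar
    linarith
  have hterm : ∀ t i j, 0 ≤ u t i j ^ 2 / (1 + |u t i j|) := fun t i j => by positivity
  have hQnn : ∀ t, 0 ≤ Q t := fun t => mul_nonneg (by norm_num)
    (Finset.sum_nonneg fun i _ => Finset.sum_nonneg fun j _ => hterm t i j)
  have hQ0 : Q =ᵐ[volume.restrict (Icc 0 T)] 0 := by
    have h1 : ∫ t in Icc 0 T, Q t = 0 := by
      rw [integral_Icc_eq_integral_Ioc, ← intervalIntegral.integral_of_le hT.le]
      exact le_antisymm hQint (intervalIntegral.integral_nonneg hT.le fun t _ => hQnn t)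
    exact (integral_eq_zero_iff_of_nonneg hQnn ((integrable_Icc_iff hT.le).1 hQI)).1 h1
  have hvS : ∀ᵐ t ∂(volume.restrict (Icc 0 T)), v t = velocity Γ w (S t) := by
    filter_upwards [hQ0, ae_restrict_mem measurableSet_Icc] with t hQt ht
    have hsum : ∑ i, ∑ j ∈ Γ.neighborFinset i, u t i j ^ 2 / (1 + |u t i j|) = 0 := by
      have : Q t = 0 := hQt
      simpa [hQ] using this
    ext i j
    by_cases hij : Γ.Adj i j
    · rw [Finset.sum_eq_zero_iff_of_nonneg fun i _ => Finset.sum_nonneg fun j _ => hterm t i j]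
        at hsum
      have h1 := hsum i (Finset.mem_univ i)
      rw [Finset.sum_eq_zero_iff_of_nonneg fun j _ => hterm t i j] at h1
      have h2 := h1 j (by simpa using hij)
      have h3 : u t i j = 0 := by
        rcases div_eq_zero_iff.1 h2 with h | h
        · exact pow_eq_zero_iff two_ne_zero |>.1 h
        · have := abs_nonneg (u t i j)
          linarith
      exact sub_eq_zero.1 h3
    · rw [(hadm.vectorField t ht).2 i j hij]
      simp [velocity, hij]
  have hsys : SolvesCoupledSystem Γ w f T ρ S := by
    refine ⟨hpos, fun t ht i => ?_, fun t ht i => ?_⟩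
    · refine hasDerivWithinAt_of_eq_add_integral (c := μ₀ i)
        (φ := fun t => -divG Γ w (ρ t) (v t) i) (continuousOn_densityRate hρc hSc i) ?_
        (fun t ht => ?_) t ht
      · filter_upwards [hvS] with t ht
        rw [ht, divG_velocity Γ hw_pos, neg_neg]
      · rw [hadm.continuity t ht i, intervalIntegral.integral_neg, sub_eq_add_neg]
    · refine hasDerivWithinAt_of_eq_add_integral (φ := fun t => α t i)
        ((continuousOn_valueRate (Γ := Γ) (w := w) hSc i).sub (hfc i)) ?_ (hSprim i) t ht
      filter_upwards [hvS] with t ht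
      simp only [hα, valueRate, dtheta]
      congr 1
      beta_reduce
      rw [ht, Finset.mul_sum, Finset.mul_sum]
      refine Finset.sum_congr rfl fun j hj => ?_
      have hij : Γ.Adj i j := by simpa using hj
      simp only [velocity, hij, if_true]
      rw [mul_pow, Real.sq_sqrt (hw_pos i j hij).le]; ring
  exact ⟨S, hsys, funext fun i => by simpa using hadm.continuity 0 h0m i, hST, hvS⟩

theorem costPW_congr_ae (hT : 0 ≤ T) {v' : ℝ → V → V → ℝ}
    (h : ∀ᵐ t ∂(volume.restrict (Icc 0 T)), v t = v' t) :
    costPW Γ F G T ρ v = costPW Γ F G T ρ v' := by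
  simp only [costPW]
  congr 1
  rw [intervalIntegral.integral_of_le hT, intervalIntegral.integral_of_le hT,
    ← integral_Icc_eq_integral_Ioc, ← integral_Icc_eq_integral_Ioc]
  refine integral_congr_ae ?_
  filter_upwards [h] with t ht
  rw [ht]

theorem costIV_congr (hT : 0 ≤ T) {S r s : ℝ → V → ℝ} (hr : EqOn r ρ (Icc 0 T))
    (hs : EqOn s S (Icc 0 T)) : costIV Γ w F G T r s = costIV Γ w F G T ρ S := by
  simp only [costIV]
  rw [hr ⟨hT, le_rfl⟩]
  congr 1
  refine intervalIntegral.integral_congr fun t ht => ?_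
  rw [uIcc_of_le hT] at ht
  simp only [hr ht, hs ht]

/-- The initial value of a value function of a path-wise minimizer is optimal: its trajectory is
the given minimizer, and every other trajectory is a competitor in the path-wise problem. -/
theorem IsPWMinimizer.isIVMinimizer [Nonempty V] (hT : 0 ≤ T) (hf : IsFirstVariation F f)
    (hf1 : ContDiffOn ℝ 1 f (openSimplex V))
    (hw : ∀ i j, w i j = w j i) (hw_pos : ∀ i j, Γ.Adj i j → 0 < w i j)
    (h : IsPWMinimizer Γ w F G μ₀ T ρ v) {S : ℝ → V → ℝ}
    (hS : IsValueFunction Γ w f g μ₀ T ρ v S) : IsIVMinimizer Γ w F G f μ₀ T (S 0) := by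
  obtain ⟨hsol, hρ0, -, hvS⟩ := hS
  refine ⟨⟨ρ, S, hsol, hρ0, rfl⟩, fun r s hrs S₀' r' s' hrs' => ?_⟩
  obtain ⟨hr, hs⟩ := hsol.eqOn hf1 hrs.1 (hrs.2.1.trans hρ0.symm) hrs.2.2
  have hadm := hrs'.1.isPWAdmissible hw hw_pos hT hf
  rw [hrs'.2.1] at hadm
  rw [costIV_congr hT hr hs, costIV_eq_costPW hw_pos, costIV_eq_costPW hw_pos,
    ← costPW_congr_ae hT hvS]
  exact h.2 _ _ hadm

theorem eq_of_forall_adj {V : Type*} {Γ : SimpleGraph V} (hΓ : Γ.Connected) {p : V → ℝ}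
    (hp : ∀ i j, Γ.Adj i j → p i = p j) (i j : V) : p i = p j := by
  obtain ⟨q⟩ := hΓ.preconnected i j
  induction q with
  | nil => rfl
  | cons hadj _ ih => exact (hp _ _ hadj).trans ih

end ValueFunction

end

end GraphMFG

open GraphMFG
theorem mainTheorem1 {V : Type*} [Fintype V] (Γ : SimpleGraph V) [DecidableRel Γ.Adj]
    (hΓ : Γ.Connected)
    (w : V → V → ℝ) (hw_symm : ∀ i j, w i j = w j i) (hw_pos : ∀ i j, Γ.Adj i j → 0 < w i j)
    (T : ℝ) (hT : 0 < T)
    (μ₀ : V → ℝ) (hμ₀ : μ₀ ∈ stdSimplex ℝ V)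
    (F G : (V → ℝ) → ℝ) (f g : (V → ℝ) → V → ℝ)
    (hF : ConvexOn ℝ (stdSimplex ℝ V) F) (hG : ConvexOn ℝ (stdSimplex ℝ V) G)
    (hf : IsFirstVariation F f) (hg : IsFirstVariation G g)
    (hf_C1 : ContDiffOn ℝ 1 f (openSimplex V)) :
    (∀ S₀, IsIVMinimizer Γ w F G f μ₀ T S₀ →
      ∀ ρ S, IsTrajectory Γ w f μ₀ T S₀ ρ S →
        IsPWMinimizer Γ w F G μ₀ T ρ (fun t => velocity Γ w (S t))) ∧
    (∀ ρ v, IsPWMinimizer Γ w F G μ₀ T ρ v → (∀ t ∈ Set.Icc 0 T, ρ t ∈ openSimplex V) →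
      (∃ S, IsValueFunction Γ w f g μ₀ T ρ v S) ∧
      ∀ S, IsValueFunction Γ w f g μ₀ T ρ v S → IsIVMinimizer Γ w F G f μ₀ T (S 0)) := by
  have hV : Nonempty V := hΓ.nonempty
  refine ⟨fun S₀ hmin ρ S h => ?_, fun ρ v h hpos =>
    ⟨h.exists_isValueFunction hT hF hf hg hf_C1 hw_symm hw_pos hpos,
      fun S hS => h.isIVMinimizer hT.le hf hf_C1 hw_symm hw_pos hS⟩⟩
  obtain ⟨hsol, hρ0, hS0⟩ := h
  have hterm : ∀ i j, Γ.Adj i j → S T i - g (ρ T) i = S T j - g (ρ T) j := fun i j hij =>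
    hsol.terminal_eq_of_adj hw_symm hw_pos hT hF hf hg hf_C1
      (fun r s hrs hr0 => hmin.2 ρ S ⟨hsol, hρ0, hS0⟩ (s 0) r s ⟨hrs, hr0.trans hρ0, rfl⟩) hij
  obtain ⟨i₀⟩ := hV
  have := hsol.isPWMinimizer hw_symm hw_pos hT.le hF hG hf hg hf_C1.continuousOn
    (c := S T i₀ - g (ρ T) i₀)
    (fun i => eq_of_forall_adj hΓ (p := fun i => S T i - g (ρ T) i) hterm i i₀)
  rwa [hρ0] at this
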